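/- Conventions. An inverse category is a category $\mathcal I$ admitting a function $\deg\colon \mathrm{ob}\,\mathcal I\to\mathbb N$ with $\deg i>\deg j$ for every non-identity map $i\to j$. For $i\in\mathcal I$ let $\partial(i/\mathcal I)$ be the full subcategory of $i/\mathcal I$ on the non-identity maps. For a diagram $X\in\mathbf C^{\mathcal I}$ the matching object is $M_iX=\lim(\partial(i/\mathcal I)\to\mathcal I\xrightarrow{X}\mathbf C)$, with matching map $m_iX\colon X_i\to M_iX$ induced by the maps $X_f$. Given a class of fibrations in $\mathbf C$, a map $p\colon E\to B$ in $\mathbf C^{\mathcal I}$ is a Reedy fibration if each relative matching map $E_i\to B_i\times_{M_iB}M_iE$ is a fibration. The pushforward of $k\colon C\to B$ along $p\colon B\to A$ is an object $p_*C\to A$ over $A$ with a universal map $\mathrm{ev}\colon p^*p_*C\to C$ over $B$: for every $T\to A$, each map $u\colon p^*T\to C$ over $B$ is $\mathrm{ev}\circ p^*(u^\dagger)$ for a unique $u^\dagger\colon T\to p_*C$ over $A$. Standing assumptions. Let $\mathcal I$ be an inverse category each of whose underslices $i/\mathcal I$ is finite (for instance a finite inverse category), and let $\mathbf C$ be a category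 with finite limits. Each of $\mathcal I$ and $\mathbf C$ is equipped with a wide subcategory of weak equivalences that contains the isomorphisms and satisfies 2-out-of-3. A diagram $\mathcal I\to\mathbf C$ is homotopical if it preserves weak equivalences. $\mathbf C$ is also equipped with a pullback-stable wide subcategory of fibrations such that pushforwards of fibrations along fibrations exist and are fibrations. Assume moreover: (1) weak equivalences in $\mathbf C$ are preserved by pullback along fibrations; (2) for every $f\colon A'\to A$ in $\mathbf C$, the functor $f^*$ takes weak equivalences over $A$ between fibrations over $A$ to weak equivalences; (3) for every fibration $p\colon B\to A$, $p_*$ takes weak equivalences over $B$ between fibrations over $B$ to weak equivalences; (4) for every commutative square $p g=f p'$ with $p\colon B\to A$, $p'\colon B'\to A'$ fibrations and $g\colon B'\to B$, $f\colon A'\to A$ weak equivalences, and every fibration $C\to B$, the map $(g^*\mathrm{ev})^\dagger\colon f^*p_*C\to p'_*g^*C$ is a weak equivalence. Lemma. Let $i\in\mathcal I$ be such that every map out of $i$ is a weak equivalence. Let $p\colon B\to A$ be a Reedy fibration between homotopical diagrams in $\mathbf C^{\mathcal I}$, and let $k\colon C\to B$ be a Reedy fibration with $C$ homotopical. Then the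 pushforward $p_*C\to A$ of $k$ along $p$ in $\mathbf C^{\mathcal I}$ exists and is a Reedy fibration, and it sends every map out of $i$ to a weak equivalence of $\mathbf C$. Moreover, for every $j$ admitting a map $i\to j$ (in particular $j=i$), the pushforward $(p_j)_*C_j$ exists in $\mathbf C$, and the comparison map $\kappa_j\colon (p_*C)_j\to (p_j)_*C_j$, the exponential transpose of the component $\mathrm{ev}_j\colon p_j^*(p_*C)_j\to C_j$ of the evaluation map, is a weak equivalence. -/

import Mathlib

open CategoryTheory CategoryTheory.Limits

universe v₁ u₁ v₂ u₂

namespace InverseDiagrams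

section Boundary

variable {I : Type u₁} [Category.{v₁} I]

/-- `I` is an inverse category: some grading of its objects by natural numbers is strictly
decreased by every map `f : i ⟶ j` that is not an identity. -/
class IsInverse (I : Type u₁) [Category.{v₁} I] : Prop where
  exists_deg : ∃ deg : I → ℕ, ∀ ⦃i j : I⦄ (f : i ⟶ j), Under.mk f ≠ Under.mk (𝟙 i) → deg j < deg i

/-- The boundary `∂(i/I)`: the full subcategory of the underslice `i/I` on the non-identity
maps out of `i`. -/
abbrev Boundary (i : I) : Type (max u₁ v₁) :=
  ObjectProperty.FullSubcategory (fun f : Under i => f ≠ Under.mk (𝟙 i))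

/-- The projection `∂(i/I) ⥤ I` sending `f : i ⟶ j` to `j`. -/
def boundaryForget (i : I) : Boundary i ⥤ I :=
  ObjectProperty.ι _ ⋙ Under.forget i

/-- An object of `∂(i/I)`, seen as a map out of `i`. -/
def boundaryHom {i : I} (f : Boundary i) : i ⟶ (boundaryForget i).obj f :=
  f.obj.hom

theorem boundaryHom_comp {i : I} {f g : Boundary i} (φ : f ⟶ g) :
    boundaryHom f ≫ (boundaryForget i).map φ = boundaryHom g :=
  Under.w φ.hom

theorem finite_boundary_hom [∀ i : I, Finite (Under i)] (i : I) (f g : Boundary i) :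
    Finite (f ⟶ g) := by
  refine Finite.of_injective
    (fun φ : f ⟶ g => (Under.mk ((boundaryForget i).map φ) : Under ((boundaryForget i).obj f))) ?_
  intro φ ψ h
  have h' : (boundaryForget i).map φ = (boundaryForget i).map ψ :=
    eq_of_heq (Comma.mk.inj h).2.2
  exact InducedCategory.hom_ext (Under.UnderMorphism.ext h')

instance hasLimitsOfShape_boundary {C : Type u₂} [Category.{v₂} C] [HasFiniteLimits C]
    [∀ i : I, Finite (Under i)] (i : I) : HasLimitsOfShape (Boundary i) C := by
  have := finite_boundary_hom i
  have : Finite (Boundary i) := Finite.of_injective (fun f => f.obj)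
    (fun f g h => by cases f; cases g; cases h; rfl)
  let e : Boundary i ≌ AsSmall.{max u₁ v₁} (Boundary i) := AsSmall.equiv
  have hobj : Finite (AsSmall.{max u₁ v₁} (Boundary i)) :=
    inferInstanceAs (Finite (ULift (Boundary i)))
  have hhom : ∀ f g : AsSmall.{max u₁ v₁} (Boundary i), Finite (f ⟶ g) := fun f g =>
    Finite.of_injective (fun φ => e.inverse.map φ) e.inverse.map_injective
  have : FinCategory (AsSmall.{max u₁ v₁} (Boundary i)) :=
    { fintypeObj := Fintype.ofFinite _
      fintypeHom := fun f g => Fintype.ofFinite _ }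
  exact hasLimitsOfShape_of_equivalence e.symm

end Boundary

section Reedy

variable {I : Type u₁} [Category.{v₁} I] {C : Type u₂} [Category.{v₂} C] [HasFiniteLimits C]
  [∀ i : I, Finite (Under i)]

/-- The matching object `M_i X`, the limit of `∂(i/I) ⥤ I ⥤ C`. -/
noncomputable def matchingObj (X : I ⥤ C) (i : I) : C :=
  limit (boundaryForget i ⋙ X)

/-- The cone on `∂(i/I) ⥤ I ⥤ C` with point `X_i` given by the maps `X_f`. -/
def matchingCone (X : I ⥤ C) (i : I) : Cone (boundaryForget i ⋙ X) where
  pt := X.obj i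
  π :=
    { app := fun f => X.map (boundaryHom f)
      naturality := fun f g φ => by
        simp [← X.map_comp, boundaryHom_comp] }

/-- The matching map `m_i X : X_i ⟶ M_i X`, induced by the maps `X_f`. -/
noncomputable def matchingMap (X : I ⥤ C) (i : I) : X.obj i ⟶ matchingObj X i :=
  limit.lift (boundaryForget i ⋙ X) (matchingCone X i)

/-- The functorial action `M_i φ : M_i X ⟶ M_i Y` of the matching object. -/
noncomputable def matchingObjMap {X Y : I ⥤ C} (φ : X ⟶ Y) (i : I) :
    matchingObj X i ⟶ matchingObj Y i :=
  limMap (Functor.whiskerLeft (boundaryForget i) φ)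

theorem matchingMap_naturality {X Y : I ⥤ C} (φ : X ⟶ Y) (i : I) :
    φ.app i ≫ matchingMap Y i = matchingMap X i ≫ matchingObjMap φ i := by
  apply limit.hom_ext
  intro f
  simp [matchingMap, matchingObjMap, matchingCone, matchingObj]

/-- The relative matching map `E_i ⟶ B_i ×_{M_i B} M_i E` of a map of diagrams `φ : E ⟶ B`. -/
noncomputable def relMatchingMap {E B : I ⥤ C} (φ : E ⟶ B) (i : I) :
    E.obj i ⟶ pullback (matchingMap B i) (matchingObjMap φ i) :=
  pullback.lift (φ.app i) (matchingMap E i) (matchingMap_naturality φ i)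

/-- A map of diagrams is a Reedy fibration when all its relative matching maps are fibrations. -/
def IsReedyFibration (Fib : MorphismProperty C) {E B : I ⥤ C} (φ : E ⟶ B) : Prop :=
  ∀ i : I, Fib (relMatchingMap φ i)

end Reedy

/-- A diagram is homotopical when it preserves weak equivalences. -/
def IsHomotopical {I : Type u₁} [Category.{v₁} I] {C : Type u₂} [Category.{v₂} C]
    (WI : MorphismProperty I) (W : MorphismProperty C) (X : I ⥤ C) : Prop :=
  ∀ ⦃i j : I⦄ (f : i ⟶ j), WI f → W (X.map f)

section Pushforward

variable {C : Type u₂} [Category.{v₂} C]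

/-- A pushforward of `k : X ⟶ B`, seen as an object over `B`, along `p : B ⟶ A`: an object
`hom : obj ⟶ A` over `A`, together with a pullback `pb = p^* obj` and a map `ev : p^* obj ⟶ X`
over `B` which is universal. That is, for each `t : T ⟶ A` with pullback `Y = p^* T`, every map
`u : Y ⟶ X` over `B` is `ev ∘ p^* v` for a unique `v : T ⟶ obj` over `A`. (Below, `w` is `p^* v`;
the conditions force `w` to be the map induced by `v` between the pullbacks.) -/
structure Pushforward {X B A : C} (k : X ⟶ B) (p : B ⟶ A) where
  /-- the domain of the pushforward `p_* X ⟶ A` -/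
  obj : C
  /-- the structure map `p_* X ⟶ A` -/
  hom : obj ⟶ A
  /-- the pullback `p^* p_* X` -/
  pb : C
  /-- the projection `p^* p_* X ⟶ p_* X` -/
  proj : pb ⟶ obj
  /-- the evaluation `p^* p_* X ⟶ X`, a map over `B` -/
  ev : pb ⟶ X
  isPullback : IsPullback proj (ev ≫ k) hom p
  existsUnique_transpose : ∀ {T Y : C} (t : T ⟶ A) (y : Y ⟶ T) (u : Y ⟶ X),
    IsPullback y (u ≫ k) t p →
      ∃! v : T ⟶ obj, v ≫ hom = t ∧ ∃ w : Y ⟶ pb, w ≫ proj = y ≫ v ∧ w ≫ ev = u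

namespace Pushforward

/-- The exponential transpose `u^† : T ⟶ p_* X` over `A` of a map `u : p^* T ⟶ X` over `B`. -/
noncomputable def transpose {X B A : C} {k : X ⟶ B} {p : B ⟶ A} (P : Pushforward k p)
    {T Y : C} (t : T ⟶ A) (y : Y ⟶ T) (u : Y ⟶ X) (h : IsPullback y (u ≫ k) t p) : T ⟶ P.obj :=
  (P.existsUnique_transpose t y u h).choose

/-- The action `p_* w : p_* X ⟶ p_* X'` of pushforward on a map `w : X ⟶ X'` over `B`. -/
noncomputable def map {X X' B A : C} {k : X ⟶ B} {k' : X' ⟶ B} {p : B ⟶ A}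
    (P : Pushforward k p) (P' : Pushforward k' p) (w : X ⟶ X') (hw : w ≫ k' = k) :
    P.obj ⟶ P'.obj :=
  P'.transpose P.hom P.proj (P.ev ≫ w) (by rw [Category.assoc, hw]; exact P.isPullback)

/-- The evaluation map `g^* ev : p'^* f^* p_* X ≅ g^* p^* p_* X ⟶ g^* X` over `B'`, for a
commutative square `g ≫ p = p' ≫ f`. Here `F = f^* p_* X`, `D = g^* X` and
`G = p'^* f^* p_* X` are arbitrary pullbacks. -/
noncomputable def pullbackEv {X B A B' A' : C} {k : X ⟶ B} {p : B ⟶ A} (P : Pushforward k p)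
    {p' : B' ⟶ A'} {g : B' ⟶ B} {f : A' ⟶ A} (sq : g ≫ p = p' ≫ f)
    {F : C} {a : F ⟶ P.obj} {a' : F ⟶ A'} (hF : IsPullback a a' P.hom f)
    {D : C} {d : D ⟶ X} {k' : D ⟶ B'} (hD : IsPullback d k' k g)
    {G : C} {b : G ⟶ F} {b' : G ⟶ B'} (hG : IsPullback b b' a' p') : G ⟶ D :=
  hD.lift
    (P.isPullback.lift (b ≫ a) (b' ≫ g)
      (by rw [Category.assoc, hF.w, ← Category.assoc, hG.w, Category.assoc, Category.assoc, sq])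
      ≫ P.ev)
    b' (by rw [Category.assoc, P.isPullback.lift_snd])

/-- The comparison map `(g^* ev)^† : f^* p_* X ⟶ p'_* g^* X` over `A'` for a commutative square
`g ≫ p = p' ≫ f`, where `F = f^* p_* X` and `D = g^* X`. -/
noncomputable def precomp [HasPullbacks C] {X B A B' A' : C} {k : X ⟶ B} {p : B ⟶ A}
    (P : Pushforward k p) {p' : B' ⟶ A'} {g : B' ⟶ B} {f : A' ⟶ A} (sq : g ≫ p = p' ≫ f)
    {F : C} {a : F ⟶ P.obj} {a' : F ⟶ A'} (hF : IsPullback a a' P.hom f)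
    {D : C} {d : D ⟶ X} {k' : D ⟶ B'} (hD : IsPullback d k' k g)
    (P' : Pushforward k' p') : F ⟶ P'.obj :=
  P'.transpose a' (pullback.fst a' p')
    (P.pullbackEv sq hF hD (IsPullback.of_hasPullback a' p'))
    (by
      rw [pullbackEv, IsPullback.lift_snd]
      exact IsPullback.of_hasPullback a' p')

/-- The comparison map `κ_j : (p_* X)_j ⟶ (p_j)_* X_j` for a pushforward of diagrams: the
exponential transpose of the component at `j` of the evaluation `ev : p^* p_* X ⟶ X`. -/
noncomputable def comparison {I : Type u₁} [Category.{v₁} I] [HasPullbacks C]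
    {X B A : I ⥤ C} {k : X ⟶ B} {p : B ⟶ A} (P : Pushforward k p) (j : I)
    (Pj : Pushforward (k.app j) (p.app j)) : P.obj.obj j ⟶ Pj.obj :=
  Pj.transpose (P.hom.app j) (P.proj.app j) (P.ev.app j)
    (P.isPullback.map ((evaluation I C).obj j))

end Pushforward

end Pushforward

section Assumptions

variable {C : Type u₂} [Category.{v₂} C]

/-- Pushforwards of fibrations along fibrations exist, and are fibrations. -/
structure FibrationsStableUnderPushforward (Fib : MorphismProperty C) : Prop where
  nonempty_pushforward : ∀ {X B A : C} (k : X ⟶ B) (p : B ⟶ A), Fib k → Fib p →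
    Nonempty (Pushforward k p)
  fib_hom : ∀ {X B A : C} {k : X ⟶ B} {p : B ⟶ A} (P : Pushforward k p), Fib k → Fib p →
    Fib P.hom

/-- Pullbacks are homotopically logically behaved. -/
structure PullbacksLogicallyBehaved (Fib W : MorphismProperty C) : Prop where
  /-- Weak equivalences are preserved by pullback along fibrations. -/
  weq_of_isPullback : ∀ {X' X Y' Y : C} {w' : X' ⟶ X} {q' : X' ⟶ Y'} {q : X ⟶ Y} {w : Y' ⟶ Y},
    IsPullback w' q' q w → Fib q → W w → W w'
  /-- Pullbacks preserve weak equivalences between fibrations: for fibrations `x : X ⟶ A` and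
  `y : Y ⟶ A`, a weak equivalence `w : X ⟶ Y` over `A`, and any `f : A' ⟶ A`, the map
  `f^* w : f^* X ⟶ f^* Y` is a weak equivalence. -/
  weq_pullback : ∀ {A' A X Y X' Y' : C} {f : A' ⟶ A} {x : X ⟶ A} {y : Y ⟶ A}
    {x₁ : X' ⟶ X} {x₂ : X' ⟶ A'} {y₁ : Y' ⟶ Y} {y₂ : Y' ⟶ A'}
    (hX : IsPullback x₁ x₂ x f) (hY : IsPullback y₁ y₂ y f) (w : X ⟶ Y) (hw : w ≫ y = x),
    Fib x → Fib y → W w →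
      W (hY.lift (x₁ ≫ w) x₂ (by rw [Category.assoc, hw, hX.w]))

/-- Pushforwards are homotopically logically behaved. -/
structure PushforwardsLogicallyBehaved [HasPullbacks C] (Fib W : MorphismProperty C) : Prop where
  /-- Pushforwards along fibrations preserve weak equivalences between fibrations. -/
  weq_map : ∀ {X X' B A : C} {k : X ⟶ B} {k' : X' ⟶ B} {p : B ⟶ A}
    (P : Pushforward k p) (P' : Pushforward k' p) (w : X ⟶ X') (hw : w ≫ k' = k),
    Fib p → Fib k → Fib k' → W w → W (P.map P' w hw)
  /-- For a commutative square with `p`, `p'` fibrations and `f`, `g` weak equivalences, and a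
  fibration `k : X ⟶ B`, the map `(g^* ev)^† : f^* p_* X ⟶ p'_* g^* X` is a weak equivalence. -/
  weq_precomp : ∀ {X B A B' A' : C} {k : X ⟶ B} {p : B ⟶ A} (P : Pushforward k p)
    {p' : B' ⟶ A'} {g : B' ⟶ B} {f : A' ⟶ A} (sq : g ≫ p = p' ≫ f)
    {F : C} {a : F ⟶ P.obj} {a' : F ⟶ A'} (hF : IsPullback a a' P.hom f)
    {D : C} {d : D ⟶ X} {k' : D ⟶ B'} (hD : IsPullback d k' k g)
    (P' : Pushforward k' p'),
    Fib k → Fib p → Fib p' → W f → W g → W (P.precomp sq hF hD P')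

end Assumptions

end InverseDiagrams

/-! A generalized element of $(p_*X)_i$ over $t\colon T\to A_i$ is a family, natural in $f\colon
i\to j$, of maps $T\times_{A_j}B_j\to X_j$ over $B_j$. These families form a presheaf on the slice
over $A_i$; once it is represented for every $i$, the representing objects assemble into a
pushforward (`repPushforward`).

Representability is proved by induction on cosieves $S$ of the finite underslice $i/\mathcal I$,
with families indexed by $S$ only (`cosieve_induction`, `exists_isRep_sec`). If $S$ contains all
composites of $f\colon i\to j$ with non-identity maps, a family on $S$ already determines a map
$T\times_{A_j}B_j\to B_j\times_{M_jB}M_jX$, and extending the family to $f$ means lifting this map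
through the relative matching map of $k$ (`pshPullback_sec`). Lifts through a fibration are
classified by a pushforward along a base change of $p_j$, hence by a fibration over the object that
represents families on $S$ (`PshPullback.exists_isRep`). Families on $\partial(i/\mathcal I)$ are
represented by $A_i\times_{M_iA}M_i(p_*X)$ (`Pushforward.isRep_relMatchingSec`), so the last step of
the induction, which adds $\mathrm{id}_i$, is the relative matching map of $p_*X\to A$. This gives
the Reedy fibration.

To reach $\kappa_i$, families are defined over any `Shape`: the restriction of $p$ to $i/\mathcal I$
is one, the constant diagram at $p_i$ another. Since $\mathrm{id}_i$ is initial in $i/\mathcal I$,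
families on the constant shape reduce to one component and are represented by $(p_i)_*X_i$; then
$\kappa_i$ is precomposition with the map from the constant shape to the restriction of $p$. On the
single component at $f$ this precomposition is the map of assumption (4) for the naturality square
of $p$ at $f$, whose sides $A_f$, $B_f$ are weak equivalences. The same induction on cosieves, with
the cogluing lemma `PullbacksLogicallyBehaved.weq_of_cospan` in the inductive step, makes it a weak
equivalence on all families (`weq_of_isRepMap_secPrecomp`).

By 2-out-of-3 the objects under $i$ inherit the hypothesis on $i$, so each $\kappa_j$ is a weak
equivalence. For $f\colon i\to j$, a square relating $\kappa_i$, $\kappa_j$, the map of (4) and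
$(p_i)_*$ of $X_i\to B_f^*X_j$ then shows that $(p_*X)_f$ is one as well. -/

namespace InverseDiagrams

universe w w₁ w₂ w₃ w₄

/-! ### Presheaves on a slice and their representing objects. -/

section Presheaves

variable {C : Type u₂} [Category.{v₂} C]

/-- A presheaf on the slice of `C` over `Z`, presented by its values on maps `t : T ⟶ Z`. -/
structure Psh (Z : C) where
  /-- the value at `t : T ⟶ Z` -/
  obj : ∀ {T : C}, (T ⟶ Z) → Type w
  /-- the restriction along a map over `Z` -/
  res : ∀ {T T' : C} {t : T ⟶ Z} {t' : T' ⟶ Z} (v : T' ⟶ T), v ≫ t = t' → obj t → obj t'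
  res_id : ∀ {T : C} {t : T ⟶ Z} (s : obj t), res (𝟙 T) (Category.id_comp t) s = s
  res_res : ∀ {T T' T'' : C} {t : T ⟶ Z} {t' : T' ⟶ Z} {t'' : T'' ⟶ Z} (v : T' ⟶ T)
    (h : v ≫ t = t') (v' : T'' ⟶ T') (h' : v' ≫ t' = t'') (s : obj t),
    res v' h' (res v h s) = res (v' ≫ v) (by rw [Category.assoc, h, h']) s

/-- A map of presheaves on a slice. -/
structure PshMap {Z : C} (F : Psh.{v₂, u₂, w₁} Z) (G : Psh.{v₂, u₂, w₂} Z) where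
  /-- the component at `t : T ⟶ Z` -/
  app : ∀ {T : C} {t : T ⟶ Z}, F.obj t → G.obj t
  app_res : ∀ {T T' : C} {t : T ⟶ Z} {t' : T' ⟶ Z} (v : T' ⟶ T) (h : v ≫ t = t') (s : F.obj t),
    app (F.res v h s) = G.res v h (app s)

/-- The object `r : R ⟶ Z` represents the presheaf `F`, with universal element `x`. -/
structure IsRep {Z R : C} (F : Psh.{v₂, u₂, w} Z) (r : R ⟶ Z) (x : F.obj r) : Prop where
  surj : ∀ {T : C} (t : T ⟶ Z) (s : F.obj t), ∃ (v : T ⟶ R) (h : v ≫ r = t), F.res v h x = s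
  inj : ∀ {T : C} {t : T ⟶ Z} {v v' : T ⟶ R} (h : v ≫ r = t) (h' : v' ≫ r = t),
    F.res v h x = F.res v' h' x → v = v'

/-- The map `e : R ⟶ R'` corresponds to the map of presheaves `φ`, for representing objects
with universal elements `x` and `x'`. -/
def IsRepMap {Z R R' : C} {F : Psh.{v₂, u₂, w₁} Z} {G : Psh.{v₂, u₂, w₂} Z} (φ : PshMap F G)
    {r : R ⟶ Z}
    (x : F.obj r) {r' : R' ⟶ Z} (x' : G.obj r') (e : R ⟶ R') : Prop :=
  ∃ h : e ≫ r' = r, G.res e h x' = φ.app x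

/-- A square of presheaves is a pullback. -/
structure PshPullback {Z : C} {F : Psh.{v₂, u₂, w₁} Z} {G : Psh.{v₂, u₂, w₂} Z}
    {K : Psh.{v₂, u₂, w₃} Z} {M : Psh.{v₂, u₂, w₄} Z}
    (π : PshMap F G) (ψ : PshMap F K) (φ : PshMap G M) (χ : PshMap K M) : Prop where
  comm : ∀ {T : C} {t : T ⟶ Z} (s : F.obj t), φ.app (π.app s) = χ.app (ψ.app s)
  lift : ∀ {T : C} {t : T ⟶ Z} (g : G.obj t) (l : K.obj t), φ.app g = χ.app l →
    ∃ s : F.obj t, π.app s = g ∧ ψ.app s = l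
  ext : ∀ {T : C} {t : T ⟶ Z} {s s' : F.obj t}, π.app s = π.app s' → ψ.app s = ψ.app s' → s = s'

theorem IsRep.exists_map {Z R R' : C} {F : Psh.{v₂, u₂, w₁} Z} {G : Psh.{v₂, u₂, w₂} Z}
    {r' : R' ⟶ Z}
    {x' : G.obj r'} (hG : IsRep G r' x') (φ : PshMap F G) {r : R ⟶ Z} (x : F.obj r) :
    ∃ e : R ⟶ R', IsRepMap φ x x' e := by
  obtain ⟨v, h, hv⟩ := hG.surj r (φ.app x)
  exact ⟨v, h, hv⟩

theorem IsRepMap.res {Z R R' : C} {F : Psh.{v₂, u₂, w₁} Z} {G : Psh.{v₂, u₂, w₂} Z}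
    {φ : PshMap F G} {r : R ⟶ Z}
    {x : F.obj r} {r' : R' ⟶ Z} {x' : G.obj r'} {e : R ⟶ R'} (he : IsRepMap φ x x' e)
    {T : C} {t : T ⟶ Z} (v : T ⟶ R) (h : v ≫ r = t) (h' : (v ≫ e) ≫ r' = t) :
    G.res (v ≫ e) h' x' = φ.app (F.res v h x) := by
  obtain ⟨h₁, h₂⟩ := he
  rw [φ.app_res, ← h₂, G.res_res]

/-- Two composites of maps between representing objects agree if the corresponding composites of
maps of presheaves agree. -/
theorem IsRepMap.comp_eq_comp {Z R R₁ R₂ R' : C} {F : Psh.{v₂, u₂, w₁} Z} {G : Psh.{v₂, u₂, w₂} Z}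
    {K : Psh.{v₂, u₂, w₃} Z} {M : Psh.{v₂, u₂, w₄} Z} {φ : PshMap F G} {χ : PshMap G M}
    {φ' : PshMap F K}
    {χ' : PshMap K M} {r : R ⟶ Z} {x : F.obj r} {r₁ : R₁ ⟶ Z} {x₁ : G.obj r₁} {r₂ : R₂ ⟶ Z}
    {x₂ : K.obj r₂} {r' : R' ⟶ Z} {x' : M.obj r'} (hM : IsRep M r' x')
    {e₁ : R ⟶ R₁} {e₂ : R₁ ⟶ R'} {d₁ : R ⟶ R₂} {d₂ : R₂ ⟶ R'}
    (he₁ : IsRepMap φ x x₁ e₁) (he₂ : IsRepMap χ x₁ x' e₂)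
    (hd₁ : IsRepMap φ' x x₂ d₁) (hd₂ : IsRepMap χ' x₂ x' d₂)
    (H : χ.app (φ.app x) = χ'.app (φ'.app x)) : e₁ ≫ e₂ = d₁ ≫ d₂ := by
  have h₁ : (e₁ ≫ e₂) ≫ r' = r := by rw [Category.assoc, he₂.1, he₁.1]
  have h₂ : (d₁ ≫ d₂) ≫ r' = r := by rw [Category.assoc, hd₂.1, hd₁.1]
  refine hM.inj h₁ h₂ ?_
  rw [he₂.res e₁ he₁.1, hd₂.res d₁ hd₁.1, he₁.2, hd₁.2, H]

/-- Representing objects are unique up to isomorphism. -/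
theorem IsRep.exists_iso {Z R R' : C} {F : Psh.{v₂, u₂, w} Z} {r : R ⟶ Z} {x : F.obj r}
    {r' : R' ⟶ Z}
    {x' : F.obj r'} (hR : IsRep F r x) (hR' : IsRep F r' x') :
    ∃ (e : R ≅ R') (h : e.hom ≫ r' = r), F.res e.hom h x' = x := by
  obtain ⟨e, h, he⟩ := hR'.surj r x
  obtain ⟨d, h', hd⟩ := hR.surj r' x'
  refine ⟨⟨e, d, ?_, ?_⟩, h, he⟩
  · refine hR.inj (t := r) (by rw [Category.assoc, h', h]) (Category.id_comp r) ?_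
    rw [F.res_id, ← F.res_res d h' e h, hd, he]
  · refine hR'.inj (t := r') (by rw [Category.assoc, h, h']) (Category.id_comp r') ?_
    rw [F.res_id, ← F.res_res e h d h', he, hd]

theorem IsRep.of_bijective {Z R : C} {F : Psh.{v₂, u₂, w₁} Z} {G : Psh.{v₂, u₂, w₂} Z}
    (φ : PshMap F G)
    (hφ : ∀ {T : C} (t : T ⟶ Z), Function.Bijective (φ.app (t := t))) {r : R ⟶ Z} {x : F.obj r}
    (hG : IsRep G r (φ.app x)) : IsRep F r x where
  surj t s := by
    obtain ⟨v, h, hv⟩ := hG.surj t (φ.app s)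
    exact ⟨v, h, (hφ t).1 (by rw [φ.app_res, hv])⟩
  inj {T t v v'} h h' H := hG.inj h h' (by rw [← φ.app_res, ← φ.app_res, H])

/-- A pullback square of presheaves gives a pullback square of representing objects. -/
theorem PshPullback.isPullback {Z E R K' M' : C} {F : Psh.{v₂, u₂, w₁} Z} {G : Psh.{v₂, u₂, w₂} Z}
    {K : Psh.{v₂, u₂, w₃} Z} {M : Psh.{v₂, u₂, w₄} Z} {π : PshMap F G} {ψ : PshMap F K}
    {φ : PshMap G M}
    {χ : PshMap K M} (H : PshPullback π ψ φ χ) {e : E ⟶ Z} {xF : F.obj e} (hF : IsRep F e xF)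
    {r : R ⟶ Z} {xG : G.obj r} (hG : IsRep G r xG) {l : K' ⟶ Z} {xK : K.obj l}
    (hK : IsRep K l xK) {m : M' ⟶ Z} {xM : M.obj m} (hM : IsRep M m xM)
    {eπ : E ⟶ R} {eψ : E ⟶ K'} {eφ : R ⟶ M'} {eχ : K' ⟶ M'}
    (hπ : IsRepMap π xF xG eπ) (hψ : IsRepMap ψ xF xK eψ) (hφ : IsRepMap φ xG xM eφ)
    (hχ : IsRepMap χ xK xM eχ) : IsPullback eπ eψ eφ eχ := by
  have w : eπ ≫ eφ = eψ ≫ eχ := IsRepMap.comp_eq_comp hM hπ hφ hψ hχ (H.comm _)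
  have hl : ∀ {T : C} (a : T ⟶ R) (b : T ⟶ K'), a ≫ eφ = b ≫ eχ →
      ∃ v : T ⟶ E, v ≫ eπ = a ∧ v ≫ eψ = b := by
    -- Yoneda: `a` and `b` are elements of the presheaves `G` and `K` over a common base, and they
    -- agree in `M`.
    intro T a b hab
    have ht : b ≫ l = a ≫ r := by rw [← hχ.1, ← hφ.1, reassoc_of% hab]
    have key : φ.app (G.res a rfl xG) = χ.app (K.res b ht xK) := by
      rw [← hφ.res a rfl (by rw [Category.assoc, hφ.1]),
        ← hχ.res b ht (by rw [Category.assoc, hχ.1, ht])]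
      congr 1
    obtain ⟨s, hs₁, hs₂⟩ := H.lift _ _ key
    obtain ⟨v, h, hv⟩ := hF.surj _ s
    have h₁ : (v ≫ eπ) ≫ r = a ≫ r := by rw [Category.assoc, hπ.1, h]
    have h₂ : (v ≫ eψ) ≫ l = a ≫ r := by rw [Category.assoc, hψ.1, h]
    exact ⟨v, hG.inj h₁ rfl (by rw [hπ.res v h, hv, hs₁]),
      hK.inj h₂ ht (by rw [hψ.res v h, hv, hs₂])⟩
  have hu : ∀ {T : C} (v v' : T ⟶ E), v ≫ eπ = v' ≫ eπ → v ≫ eψ = v' ≫ eψ → v = v' := by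
    intro T v v' h₁ h₂
    have h : v' ≫ e = v ≫ e := by rw [← hπ.1, reassoc_of% h₁]
    refine hF.inj rfl h (H.ext ?_ ?_)
    · rw [← hπ.res v rfl (by rw [Category.assoc, hπ.1]),
        ← hπ.res v' h (by rw [Category.assoc, hπ.1, h])]
      congr 1
    · rw [← hψ.res v rfl (by rw [Category.assoc, hψ.1]),
        ← hψ.res v' h (by rw [Category.assoc, hψ.1, h])]
      congr 1
  refine ⟨⟨w⟩, ⟨PullbackCone.IsLimit.mk w (fun s => (hl s.fst s.snd s.condition).choose)
    (fun s => (hl s.fst s.snd s.condition).choose_spec.1)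
    (fun s => (hl s.fst s.snd s.condition).choose_spec.2) ?_⟩⟩
  intro s v h₁ h₂
  have h := (hl s.fst s.snd s.condition).choose_spec
  exact hu _ _ (h₁.trans h.1.symm) (h₂.trans h.2.symm)

end Presheaves

/-! ### Presheaves of maps out of a base change, described by generalized elements. -/

section HomPsh

variable {C : Type u₂} [Category.{v₂} C] [HasPullbacks C]

/-- The presheaf sending `t : T ⟶ Z` to the maps `T ×_{A} Y ⟶ X` over `B`. -/
@[ext]
structure HomSec {Z A Y B X : C} (a : Z ⟶ A) (q : Y ⟶ A) (b : Y ⟶ B) (k : X ⟶ B) {T : C}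
    (t : T ⟶ Z) where
  /-- the underlying map -/
  hom : pullback (t ≫ a) q ⟶ X
  hom_comp : hom ≫ k = pullback.snd (t ≫ a) q ≫ b

namespace HomSec

variable {Z A Y B X : C} {a : Z ⟶ A} {q : Y ⟶ A} {b : Y ⟶ B} {k : X ⟶ B} {T : C} {t : T ⟶ Z}

/-- The value of a map `T ×_{A} Y ⟶ X` on a generalized element. -/
noncomputable def eval (u : HomSec a q b k t) {V : C} (x : V ⟶ T) (y : V ⟶ Y)
    (h : x ≫ t ≫ a = y ≫ q) : V ⟶ X :=
  pullback.lift x y h ≫ u.hom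

theorem eval_over (u : HomSec a q b k t) {V : C} (x : V ⟶ T) (y : V ⟶ Y)
    (h : x ≫ t ≫ a = y ≫ q) : u.eval x y h ≫ k = y ≫ b := by
  rw [eval, Category.assoc, u.hom_comp, pullback.lift_snd_assoc]

theorem comp_eval (u : HomSec a q b k t) {V V' : C} (z : V' ⟶ V) (x : V ⟶ T) (y : V ⟶ Y)
    (h : x ≫ t ≫ a = y ≫ q) :
    z ≫ u.eval x y h = u.eval (z ≫ x) (z ≫ y) (by rw [Category.assoc, h, Category.assoc]) := by
  rw [eval, eval, ← Category.assoc]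
  congr 1
  apply pullback.hom_ext <;> simp only [Category.assoc, pullback.lift_fst, pullback.lift_snd]

/-- The two projections form the generic element, so the values on generalized elements determine
the map. -/
theorem eval_fst_snd (u : HomSec a q b k t) :
    u.eval (pullback.fst (t ≫ a) q) (pullback.snd (t ≫ a) q) pullback.condition = u.hom := by
  rw [eval]
  convert Category.id_comp _
  apply pullback.hom_ext
  · rw [pullback.lift_fst, Category.id_comp]
  · rw [pullback.lift_snd, Category.id_comp]

theorem ext_eval {u u' : HomSec a q b k t}
    (h : ∀ {V : C} (x : V ⟶ T) (y : V ⟶ Y) (h : x ≫ t ≫ a = y ≫ q),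
      u.eval x y h = u'.eval x y h) : u = u' := by
  ext
  rw [← u.eval_fst_snd, h, u'.eval_fst_snd]

/-- A map `T ×_{A} Y ⟶ X` over `B` given by its values on generalized elements. -/
noncomputable def ofEval (e : ∀ {V : C} (x : V ⟶ T) (y : V ⟶ Y), x ≫ t ≫ a = y ≫ q → (V ⟶ X))
    (he : ∀ {V : C} (x : V ⟶ T) (y : V ⟶ Y) (h : x ≫ t ≫ a = y ≫ q), e x y h ≫ k = y ≫ b) :
    HomSec a q b k t where
  hom := e (pullback.fst _ _) (pullback.snd _ _) pullback.condition
  hom_comp := he _ _ _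

theorem eval_ofEval (e : ∀ {V : C} (x : V ⟶ T) (y : V ⟶ Y), x ≫ t ≫ a = y ≫ q → (V ⟶ X))
    (he : ∀ {V : C} (x : V ⟶ T) (y : V ⟶ Y) (h : x ≫ t ≫ a = y ≫ q), e x y h ≫ k = y ≫ b)
    (hc : ∀ {V V' : C} (z : V' ⟶ V) (x : V ⟶ T) (y : V ⟶ Y) (h : x ≫ t ≫ a = y ≫ q),
      z ≫ e x y h = e (z ≫ x) (z ≫ y) (by rw [Category.assoc, h, Category.assoc]))
    {V : C} (x : V ⟶ T) (y : V ⟶ Y) (h : x ≫ t ≫ a = y ≫ q) :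
    (ofEval e he).eval x y h = e x y h := by
  rw [eval, ofEval, hc]
  congr 1
  · exact pullback.lift_fst _ _ _
  · exact pullback.lift_snd _ _ _

theorem eval_congr (u : HomSec a q b k t) {V : C} {x x' : V ⟶ T} {y y' : V ⟶ Y}
    (hx : x = x') (hy : y = y') (h : x ≫ t ≫ a = y ≫ q) :
    u.eval x y h = u.eval x' y' (by rw [← hx, ← hy, h]) := by
  subst hx hy
  rfl

/-- Restriction of a map `T ×_{A} Y ⟶ X` along `v : T' ⟶ T`. -/
noncomputable def res {T' : C} {t' : T' ⟶ Z} (v : T' ⟶ T) (h : v ≫ t = t')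
    (u : HomSec a q b k t) : HomSec a q b k t' :=
  ofEval (fun x y hxy => u.eval (x ≫ v) y (by rw [Category.assoc, ← hxy, ← h, Category.assoc]))
    (fun _ _ _ => u.eval_over _ _ _)

theorem eval_res {T' : C} {t' : T' ⟶ Z} (v : T' ⟶ T) (h : v ≫ t = t')
    (u : HomSec a q b k t) {V : C} (x : V ⟶ T') (y : V ⟶ Y) (hxy : x ≫ t' ≫ a = y ≫ q) :
    (u.res v h).eval x y hxy =
      u.eval (x ≫ v) y (by rw [Category.assoc, ← hxy, ← h, Category.assoc]) := by
  refine eval_ofEval _ (fun _ _ _ => u.eval_over _ _ _) (fun z x y h => ?_) x y hxy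
  rw [comp_eval]
  exact eval_congr u (Category.assoc _ _ _).symm rfl _

end HomSec

/-- The presheaf of maps `T ×_{A} Y ⟶ X` over `B`. -/
noncomputable abbrev homPsh {Z A Y B X : C} (a : Z ⟶ A) (q : Y ⟶ A) (b : Y ⟶ B) (k : X ⟶ B) :
    Psh.{v₂, u₂, v₂} Z where
  obj t := HomSec a q b k t
  res v h u := u.res v h
  res_id s := HomSec.ext_eval fun x y h => by
    rw [HomSec.eval_res]
    exact HomSec.eval_congr _ (by simp) rfl _
  res_res v h v' h' s := HomSec.ext_eval fun x y h => by
    rw [HomSec.eval_res, HomSec.eval_res, HomSec.eval_res]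
    exact HomSec.eval_congr _ (by simp) rfl _

theorem homPsh.eval_res {Z A Y B X : C} {a : Z ⟶ A} {q : Y ⟶ A} {b : Y ⟶ B} {k : X ⟶ B}
    {T T' : C} {t : T ⟶ Z} {t' : T' ⟶ Z} (v : T' ⟶ T) (h : v ≫ t = t')
    (u : HomSec a q b k t) {V : C} (x : V ⟶ T') (y : V ⟶ Y) (hxy : x ≫ t' ≫ a = y ≫ q) :
    HomSec.eval ((homPsh a q b k).res v h u) x y hxy =
      u.eval (x ≫ v) y (by rw [Category.assoc, ← hxy, ← h, Category.assoc]) :=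
  HomSec.eval_res v h u x y hxy

/-- Postcomposition with a map `m : X ⟶ N` over `B`. -/
noncomputable def HomSec.postcomp {Z A Y B X N : C} {a : Z ⟶ A} {q : Y ⟶ A} {b : Y ⟶ B}
    {k : X ⟶ B} {n : N ⟶ B} (m : X ⟶ N) (hm : m ≫ n = k) {T : C} {t : T ⟶ Z}
    (u : HomSec a q b k t) : HomSec a q b n t where
  hom := u.hom ≫ m
  hom_comp := by rw [Category.assoc, hm, u.hom_comp]

theorem HomSec.eval_postcomp {Z A Y B X N : C} {a : Z ⟶ A} {q : Y ⟶ A} {b : Y ⟶ B}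
    {k : X ⟶ B} {n : N ⟶ B} (m : X ⟶ N) (hm : m ≫ n = k) {T : C} {t : T ⟶ Z}
    (u : HomSec a q b k t) {V : C} (x : V ⟶ T) (y : V ⟶ Y) (h : x ≫ t ≫ a = y ≫ q) :
    (u.postcomp m hm).eval x y h = u.eval x y h ≫ m := by
  simp only [HomSec.eval, HomSec.postcomp, Category.assoc]

/-- Postcomposition with a map `m : X ⟶ N` over `B`, as a map of presheaves. -/
noncomputable def homPsh.postcomp {Z A Y B X N : C} (a : Z ⟶ A) (q : Y ⟶ A) (b : Y ⟶ B)
    {k : X ⟶ B} {n : N ⟶ B} (m : X ⟶ N) (hm : m ≫ n = k) :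
    PshMap (homPsh a q b k) (homPsh a q b n) where
  app u := HomSec.postcomp m hm u
  app_res v hv u := HomSec.ext_eval fun x y h => by
    change (HomSec.postcomp m hm (HomSec.res v hv u)).eval x y h =
      (HomSec.res v hv (HomSec.postcomp m hm u)).eval x y h
    rw [HomSec.eval_postcomp, HomSec.eval_res, HomSec.eval_res, HomSec.eval_postcomp]

end HomPsh

/-! ### Representing presheaves of maps, and of lifts through a fibration, by pushforwards. -/

section Representability

variable {C : Type u₂} [Category.{v₂} C]

theorem Pushforward.transpose_hom {X B A : C} {k : X ⟶ B} {p : B ⟶ A} (P : Pushforward k p)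
    {T Y : C} (t : T ⟶ A) (y : Y ⟶ T) (u : Y ⟶ X) (h : IsPullback y (u ≫ k) t p) :
    P.transpose t y u h ≫ P.hom = t :=
  (P.existsUnique_transpose t y u h).choose_spec.1.1

theorem Pushforward.exists_transpose {X B A : C} {k : X ⟶ B} {p : B ⟶ A} (P : Pushforward k p)
    {T Y : C} (t : T ⟶ A) (y : Y ⟶ T) (u : Y ⟶ X) (h : IsPullback y (u ≫ k) t p) :
    ∃ w : Y ⟶ P.pb, w ≫ P.proj = y ≫ P.transpose t y u h ∧ w ≫ P.ev = u :=
  (P.existsUnique_transpose t y u h).choose_spec.1.2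

/-- The value of the evaluation map of a pushforward on a generalized element. -/
noncomputable def Pushforward.evalAt {X B A : C} {k : X ⟶ B} {p : B ⟶ A} (P : Pushforward k p)
    {V : C} (x : V ⟶ P.obj) (y : V ⟶ B) (h : x ≫ P.hom = y ≫ p) : V ⟶ X :=
  P.isPullback.lift x y h ≫ P.ev

theorem Pushforward.evalAt_comp {X B A : C} {k : X ⟶ B} {p : B ⟶ A} (P : Pushforward k p)
    {V : C} (x : V ⟶ P.obj) (y : V ⟶ B) (h : x ≫ P.hom = y ≫ p) : P.evalAt x y h ≫ k = y := by
  rw [evalAt, Category.assoc, P.isPullback.lift_snd]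

theorem Pushforward.comp_evalAt {X B A : C} {k : X ⟶ B} {p : B ⟶ A} (P : Pushforward k p)
    {V V' : C} (z : V' ⟶ V) (x : V ⟶ P.obj) (y : V ⟶ B) (h : x ≫ P.hom = y ≫ p) :
    z ≫ P.evalAt x y h = P.evalAt (z ≫ x) (z ≫ y) (by rw [Category.assoc, h, Category.assoc]) := by
  rw [evalAt, evalAt, ← Category.assoc]
  congr 1
  apply P.isPullback.hom_ext
  · rw [P.isPullback.lift_fst, Category.assoc, P.isPullback.lift_fst]
  · rw [P.isPullback.lift_snd, Category.assoc, P.isPullback.lift_snd]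

theorem Pushforward.evalAt_congr {X B A : C} {k : X ⟶ B} {p : B ⟶ A} (P : Pushforward k p)
    {V : C} {x x' : V ⟶ P.obj} {y y' : V ⟶ B} (hx : x = x') (hy : y = y')
    (h : x ≫ P.hom = y ≫ p) : P.evalAt x y h = P.evalAt x' y' (by rw [← hx, ← hy, h]) := by
  subst hx hy
  rfl

/-- The universal property of a pushforward in terms of generalized elements: a map `T ⟶ p_* X`
over `A` is determined by its values. -/
theorem Pushforward.hom_ext {X B A : C} {k : X ⟶ B} {p : B ⟶ A} (P : Pushforward k p)
    {T Y : C} {y : Y ⟶ T} {b : Y ⟶ B} {v v' : T ⟶ P.obj} (hv : v ≫ P.hom = v' ≫ P.hom)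
    (h : IsPullback y b (v ≫ P.hom) p)
    (H : P.evalAt (y ≫ v) b (by rw [Category.assoc, h.w]) =
      P.evalAt (y ≫ v') b (by rw [Category.assoc, ← hv, h.w])) : v = v' := by
  have hp : IsPullback y (P.evalAt (y ≫ v) b (by rw [Category.assoc, h.w]) ≫ k) (v ≫ P.hom) p := by
    rw [P.evalAt_comp]
    exact h
  refine (P.existsUnique_transpose (v ≫ P.hom) y _ hp).unique
    ⟨rfl, P.isPullback.lift (y ≫ v) b (by rw [Category.assoc, h.w]), P.isPullback.lift_fst _ _ _,
      rfl⟩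
    ⟨hv.symm, P.isPullback.lift (y ≫ v') b (by rw [Category.assoc, ← hv, h.w]),
      P.isPullback.lift_fst _ _ _, H.symm⟩

theorem Pushforward.evalAt_transpose {X B A : C} {k : X ⟶ B} {p : B ⟶ A} (P : Pushforward k p)
    {T Y : C} (t : T ⟶ A) (y : Y ⟶ T) (u : Y ⟶ X) (h : IsPullback y (u ≫ k) t p) {V : C}
    (x : V ⟶ P.obj) (b : V ⟶ B) (hx : x ≫ P.hom = b ≫ p) (z : V ⟶ Y)
    (hzx : z ≫ y ≫ P.transpose t y u h = x) (hzb : z ≫ u ≫ k = b) : P.evalAt x b hx = z ≫ u := by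
  obtain ⟨w, hw₁, hw₂⟩ := P.exists_transpose t y u h
  rw [evalAt, ← hw₂, ← Category.assoc]
  congr 1
  apply P.isPullback.hom_ext
  · rw [P.isPullback.lift_fst, Category.assoc, hw₁, hzx]
  · rw [P.isPullback.lift_snd, Category.assoc, ← Category.assoc w, hw₂, hzb]

variable [HasPullbacks C]

/-- The universal element of a presheaf of maps given by a pushforward. -/
noncomputable def Pushforward.homSec {Z A Y B X D F : C} {a : Z ⟶ A} {q : Y ⟶ A} {b : Y ⟶ B}
    {k : X ⟶ B} {d : D ⟶ X} {k' : D ⟶ Y} (hD : CommSq d k' k b) (P : Pushforward k' q)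
    {f : F ⟶ P.obj} {r : F ⟶ Z} (hF : CommSq f r P.hom a) : HomSec a q b k r :=
  HomSec.ofEval (fun x y h => P.evalAt (x ≫ f) y (by rw [Category.assoc, hF.w, h]) ≫ d)
    (fun x y h => by rw [Category.assoc, hD.w, ← Category.assoc, P.evalAt_comp])

theorem Pushforward.eval_homSec {Z A Y B X D F : C} {a : Z ⟶ A} {q : Y ⟶ A} {b : Y ⟶ B}
    {k : X ⟶ B} {d : D ⟶ X} {k' : D ⟶ Y} (hD : CommSq d k' k b) (P : Pushforward k' q)
    {f : F ⟶ P.obj} {r : F ⟶ Z} (hF : CommSq f r P.hom a) {V : C} (x : V ⟶ F) (y : V ⟶ Y)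
    (h : x ≫ r ≫ a = y ≫ q) :
    (P.homSec hD hF).eval x y h = P.evalAt (x ≫ f) y (by rw [Category.assoc, hF.w, h]) ≫ d := by
  refine HomSec.eval_ofEval _ (fun x y h => by
    rw [Category.assoc, hD.w, ← Category.assoc, P.evalAt_comp]) (fun z x y h => ?_) x y h
  rw [← Category.assoc, P.comp_evalAt]
  congr 1
  exact P.evalAt_congr (Category.assoc _ _ _).symm rfl _

/-- A pullback of a pushforward represents a presheaf of maps. -/
theorem Pushforward.isRep_homSec {Z A Y B X D F : C} {a : Z ⟶ A} {q : Y ⟶ A} {b : Y ⟶ B}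
    {k : X ⟶ B} {d : D ⟶ X} {k' : D ⟶ Y} (hD : IsPullback d k' k b) (P : Pushforward k' q)
    {f : F ⟶ P.obj} {r : F ⟶ Z} (hF : IsPullback f r P.hom a) :
    IsRep (homPsh a q b k) r (P.homSec hD.toCommSq hF.toCommSq) where
  surj {T} t s := by
    let u : pullback (t ≫ a) q ⟶ D := hD.lift s.hom (pullback.snd _ _) s.hom_comp
    have hu : IsPullback (pullback.fst (t ≫ a) q) (u ≫ k') (t ≫ a) q := by
      rw [hD.lift_snd]
      exact IsPullback.of_hasPullback _ _
    refine ⟨hF.lift (P.transpose _ _ u hu) t (P.transpose_hom _ _ _ _), hF.lift_snd _ _ _,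
      HomSec.ext_eval fun {V} x y h => ?_⟩
    rw [homPsh.eval_res, P.eval_homSec, P.evalAt_transpose _ _ u hu _ _ _ (pullback.lift x y h),
      Category.assoc, hD.lift_fst, HomSec.eval]
    · rw [Category.assoc, hF.lift_fst, pullback.lift_fst_assoc]
    · rw [hD.lift_snd, pullback.lift_snd]
  inj {T t v v'} h h' H := by
    refine hF.hom_ext ?_ (by rw [h, h'])
    have e : v ≫ f ≫ P.hom = t ≫ a := by rw [hF.w, ← Category.assoc, h]
    have e' : v' ≫ f ≫ P.hom = t ≫ a := by rw [hF.w, ← Category.assoc, h']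
    have hp : IsPullback (pullback.fst (t ≫ a) q) (pullback.snd (t ≫ a) q)
        ((v ≫ f) ≫ P.hom) q := by
      rw [Category.assoc, e]
      exact IsPullback.of_hasPullback _ _
    refine P.hom_ext (by simp [e, e']) hp (hD.hom_ext ?_ ?_)
    · have H' := congrArg (fun s : HomSec a q b k t =>
        s.eval (pullback.fst _ _) (pullback.snd _ _) pullback.condition) H
      dsimp only at H'
      rw [homPsh.eval_res, homPsh.eval_res, P.eval_homSec, P.eval_homSec] at H'
      rw [P.evalAt_congr (Category.assoc _ _ _).symm rfl, H']
      congr 1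
      exact P.evalAt_congr (Category.assoc _ _ _) rfl _
    · rw [P.evalAt_comp, P.evalAt_comp]

/-- Pullback pasting: $T\times_AY$ is the base change of $R\times_AY$ along `v`. -/
theorem isPullback_pullback_lift {Z A Y R T : C} {r : R ⟶ Z} {t : T ⟶ Z} (v : T ⟶ R)
    (hv : v ≫ r = t) (a : Z ⟶ A) (q : Y ⟶ A) :
    IsPullback (pullback.fst (t ≫ a) q)
      (pullback.lift (pullback.fst (t ≫ a) q ≫ v) (pullback.snd (t ≫ a) q)
        (by rw [← pullback.condition, Category.assoc, reassoc_of% hv])) v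
      (pullback.fst (r ≫ a) q) := by
  refine (IsPullback.of_right (h₁₂ := pullback.snd (r ≫ a) q) (v₁₃ := q) (h₂₂ := r ≫ a) ?_
    (pullback.lift_fst _ _ _) (IsPullback.of_hasPullback _ _).flip).flip
  rw [pullback.lift_snd, reassoc_of% hv]
  exact (IsPullback.of_hasPullback _ _).flip

variable {Fib : MorphismProperty C}

/-- If `F` is the pullback of `G` along the postcomposition by a fibration on presheaves of maps,
then `F` is represented by a fibration over a representing object of `G`. -/
theorem PshPullback.exists_isRep [Fib.IsStableUnderBaseChange]
    (hFib : FibrationsStableUnderPushforward Fib) {Z A Y B X N R : C} {G : Psh.{v₂, u₂, w₂} Z}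
    {r : R ⟶ Z} {x : G.obj r} (hG : IsRep G r x) {F : Psh.{v₂, u₂, w₁} Z} {a : Z ⟶ A} {q : Y ⟶ A}
    {b : Y ⟶ B} {k : X ⟶ B} {n : N ⟶ B} {m : X ⟶ N} {hm : m ≫ n = k} {π : PshMap F G}
    {ψ : PshMap F (homPsh a q b k)} {φ : PshMap G (homPsh a q b n)}
    (H : PshPullback π ψ φ (homPsh.postcomp a q b m hm)) (hmF : Fib m) (hq : Fib q) :
    ∃ (E : C) (e : E ⟶ R) (y : F.obj (e ≫ r)), IsRep F (e ≫ r) y ∧ IsRepMap π y x e ∧ Fib e := by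
  -- The universal element of `G` gives the generic map `o` to be lifted through `m`. Its lifts are
  -- sections of the base change `k'` of `m` along `o`, and the pushforward of `k'` along
  -- $R\times_AY\to R$ classifies them.
  let o : HomSec a q b n r := φ.app x
  let p : pullback (r ≫ a) q ⟶ R := pullback.fst _ _
  let k' : pullback o.hom m ⟶ pullback (r ≫ a) q := pullback.fst _ _
  have hp : Fib p := MorphismProperty.of_isPullback
    (IsPullback.of_hasPullback (r ≫ a) q).flip hq
  have hk' : Fib k' := MorphismProperty.of_isPullback
    (IsPullback.of_hasPullback o.hom m).flip hmF
  obtain ⟨P⟩ := hFib.nonempty_pushforward k' p hk' hp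
  have hbc : ∀ {V : C} (x₁ : V ⟶ R) (y₁ : V ⟶ Y) (h : x₁ ≫ r ≫ a = y₁ ≫ q),
      o.eval x₁ y₁ h = pullback.lift x₁ y₁ h ≫ o.hom := fun _ _ _ => rfl
  -- The generic lift: the evaluation of `P` lands in the pullback of `o.hom` and `m`, and its
  -- projection to `X` lifts `o` by the pullback condition.
  let uev : ∀ {V : C} (x₁ : V ⟶ P.obj) (y₁ : V ⟶ Y), x₁ ≫ (P.hom ≫ r) ≫ a = y₁ ≫ q → (V ⟶ X) :=
    fun {V} x₁ y₁ h => P.evalAt x₁ (pullback.lift (x₁ ≫ P.hom) y₁ (by simpa using h))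
      (pullback.lift_fst _ _ _).symm ≫ pullback.snd _ _
  have huev : ∀ {V : C} (x₁ : V ⟶ P.obj) (y₁ : V ⟶ Y) (h : x₁ ≫ (P.hom ≫ r) ≫ a = y₁ ≫ q),
      uev x₁ y₁ h ≫ m = o.eval (x₁ ≫ P.hom) y₁ (by simpa using h) := by
    intro V x₁ y₁ h
    simp only [uev]
    rw [Category.assoc, ← pullback.condition, ← Category.assoc, P.evalAt_comp, hbc]
  let u : HomSec a q b k (P.hom ≫ r) := HomSec.ofEval uev (fun x₁ y₁ h => by
    rw [← hm, ← Category.assoc, huev x₁ y₁ h]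
    exact HomSec.eval_over _ _ _ _)
  have hu : ∀ {V : C} (x₁ : V ⟶ P.obj) (y₁ : V ⟶ Y) (h : x₁ ≫ (P.hom ≫ r) ≫ a = y₁ ≫ q),
      u.eval x₁ y₁ h = uev x₁ y₁ h := by
    refine HomSec.eval_ofEval _ _ (fun z x₁ y₁ h => ?_)
    simp only [uev]
    rw [← Category.assoc, P.comp_evalAt]
    congr 1
    refine P.evalAt_congr rfl ?_ _
    apply pullback.hom_ext
    · rw [Category.assoc, pullback.lift_fst, pullback.lift_fst, Category.assoc]
    · rw [Category.assoc, pullback.lift_snd, pullback.lift_snd]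
  obtain ⟨y, hy₁, hy₂⟩ := H.lift (G.res P.hom rfl x) u (by
    rw [φ.app_res]
    refine HomSec.ext_eval fun x₁ y₁ h => ?_
    rw [homPsh.eval_res]
    exact ((HomSec.eval_postcomp m hm u x₁ y₁ h).trans (by rw [hu x₁ y₁ h, huev x₁ y₁ h])).symm)
  have hye : ∀ {T : C} {t : T ⟶ Z} (v : T ⟶ P.obj) (h : v ≫ P.hom ≫ r = t) {V : C} (x₁ : V ⟶ T)
      (y₁ : V ⟶ Y) (h' : x₁ ≫ t ≫ a = y₁ ≫ q), HomSec.eval (ψ.app (F.res v h y)) x₁ y₁ h' =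
        uev (x₁ ≫ v) y₁ (by rw [← h', ← h]; simp) := by
    intro T t v h V x₁ y₁ h'
    rw [ψ.app_res, hy₂]
    rw [homPsh.eval_res, hu]
  refine ⟨P.obj, P.hom, y, ⟨?_, ?_⟩, ⟨rfl, hy₁.symm⟩, hFib.fib_hom P hk' hp⟩
  · intro T t s
    -- The `G`-part of `s` gives `v : T ⟶ R`. Its other part is a lift through `m` of the
    -- restriction of `o` along `v`, so it defines a map `l` into the base change of `m`, and the
    -- required map is the transpose of `l` over `v`.
    obtain ⟨v, hv, hvs⟩ := hG.surj t (π.app s)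
    have hvφ : ∀ {V : C} (x₁ : V ⟶ T) (y₁ : V ⟶ Y) (h : x₁ ≫ t ≫ a = y₁ ≫ q),
        o.eval (x₁ ≫ v) y₁ (by rw [← h, ← hv]; simp) = HomSec.eval (ψ.app s) x₁ y₁ h ≫ m := by
      intro V x₁ y₁ h
      have := H.comm s
      rw [← hvs, φ.app_res] at this
      rw [← HomSec.eval_postcomp m hm, ← homPsh.eval_res v hv]
      exact congrArg (fun s : HomSec a q b n t => s.eval x₁ y₁ h) this
    let z : pullback (t ≫ a) q ⟶ pullback (r ≫ a) q :=
      pullback.lift (pullback.fst _ _ ≫ v) (pullback.snd _ _)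
        (by rw [← pullback.condition, ← hv]; simp)
    let l : pullback (t ≫ a) q ⟶ pullback o.hom m :=
      pullback.lift z (HomSec.hom (ψ.app s)) (by
        have := hvφ (pullback.fst _ _) (pullback.snd _ _) pullback.condition
        rwa [HomSec.eval_fst_snd] at this)
    have hz : IsPullback (pullback.fst (t ≫ a) q) z v p :=
      isPullback_pullback_lift v hv a q
    have hl : IsPullback (pullback.fst (t ≫ a) q) (l ≫ k') v p := by
      rw [show l ≫ k' = z from pullback.lift_fst _ _ _]
      exact hz
    have hvt : P.transpose v _ l hl ≫ P.hom ≫ r = t := by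
      rw [← Category.assoc, P.transpose_hom, hv]
    refine ⟨P.transpose v _ l hl, hvt, H.ext ?_ ?_⟩
    · rw [π.app_res, hy₁, G.res_res, ← hvs]
      congr 1
      exact P.transpose_hom _ _ _ _
    · refine HomSec.ext_eval fun x₁ y₁ h => ?_
      rw [hye]
      simp only [uev]
      rw [P.evalAt_transpose v _ l hl _ _ _ (pullback.lift x₁ y₁ h), Category.assoc,
        show l ≫ pullback.snd o.hom m = _ from pullback.lift_snd _ _ _, HomSec.eval]
      · rw [pullback.lift_fst_assoc]
      · rw [show l ≫ k' = z from pullback.lift_fst _ _ _]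
        dsimp only [z]
        apply pullback.hom_ext
        · rw [Category.assoc, pullback.lift_fst, pullback.lift_fst_assoc, pullback.lift_fst,
            Category.assoc, P.transpose_hom]
        · rw [Category.assoc, pullback.lift_snd, pullback.lift_snd, pullback.lift_snd]
  · intro T t v v' h h' hvv
    have h₁ : v ≫ P.hom = v' ≫ P.hom := by
      refine hG.inj (t := t) (by simpa using h) (by simpa using h') ?_
      have := congrArg π.app hvv
      rwa [π.app_res, π.app_res, hy₁, G.res_res, G.res_res] at this
    have hz := isPullback_pullback_lift (v ≫ P.hom) (show (v ≫ P.hom) ≫ r = t by simpa using h) a q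
    refine P.hom_ext h₁ hz (pullback.hom_ext ?_ ?_)
    · rw [P.evalAt_comp, P.evalAt_comp]
    · have h₂ := congrArg (fun s => HomSec.eval (ψ.app s) (pullback.fst _ _) (pullback.snd _ _)
        pullback.condition) hvv
      rw [hye, hye] at h₂
      simp only [uev] at h₂
      convert h₂ using 2
      · refine P.evalAt_congr rfl ?_ _
        congr 1
        exact (Category.assoc _ _ _).symm
      · refine P.evalAt_congr rfl ?_ _
        congr 1
        rw [Category.assoc, h₁]

end Representability

/-! ### Cosieves in an underslice and induction on them. -/

section Cosieves

variable {I : Type u₁} [Category.{v₁} I]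

/-- An equality in `Under i` expresses that `u` is an identity without assuming that its target is
`i`; the price is an `eqToHom`. -/
theorem eq_of_underMk_eq_id {i j : I} {u : i ⟶ j} (h : Under.mk u = Under.mk (𝟙 i)) :
    ∃ e : i = j, u = eqToHom e := by
  obtain rfl : j = i := congrArg (fun f : Under i => f.right) h
  exact ⟨rfl, eq_of_heq (Comma.mk.inj h).2.2⟩

theorem eq_of_underMk_right_eq_id {i : I} {f f' : Under i} (g : f ⟶ f')
    (h : Under.mk g.right = Under.mk (𝟙 f.right)) : f = f' := by
  obtain ⟨e, he⟩ := eq_of_underMk_eq_id h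
  have hw : f.hom ≫ g.right = f'.hom := Under.w g
  rw [he] at hw
  obtain ⟨⟨⟨⟩⟩, r, f⟩ := f
  obtain ⟨⟨⟨⟩⟩, r', f'⟩ := f'
  change r = r' at e
  subst e
  congr 1
  simpa using hw

/-- A set of maps out of `i` is a cosieve when it is closed under postcomposition. -/
def IsCosieve {i : I} (S : Set (Under i)) : Prop :=
  ∀ ⦃f g : Under i⦄, (f ⟶ g) → f ∈ S → g ∈ S

/-- The composite of `f : i ⟶ j` with a non-identity map out of `j`. -/
abbrev extend {i : I} (f : Under i) (h : Boundary f.right) : Under i :=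
  Under.mk (f.hom ≫ h.obj.hom)

/-- The map from `f` to its composite with a non-identity map. -/
abbrev toExtend {i : I} (f : Under i) (h : Boundary f.right) : f ⟶ extend f h :=
  Under.homMk h.obj.hom

/-- The functoriality of composition with non-identity maps. -/
abbrev extendMap {i : I} (f : Under i) {h h' : Boundary f.right} (φ : h ⟶ h') :
    extend f h ⟶ extend f h' :=
  Under.homMk φ.hom.right (by
    change (f.hom ≫ h.obj.hom) ≫ _ = f.hom ≫ h'.obj.hom
    rw [Category.assoc, Under.w])

theorem toExtend_comp_extendMap {i : I} (f : Under i) {h h' : Boundary f.right} (φ : h ⟶ h') :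
    toExtend f h ≫ extendMap f φ = toExtend f h' := by
  ext
  exact Under.w φ.hom

/-- A cosieve is built up one map at a time in order of increasing degree of the target. Each new
map then arrives after all of its composites with non-identity maps. -/
theorem cosieve_induction [IsInverse I] {i : I} [Finite (Under i)] {P : Set (Under i) → Prop}
    (h₀ : P ∅) (h₁ : ∀ (f : Under i) (S : Set (Under i)), f ∉ S → IsCosieve S →
      (∀ h : Boundary f.right, extend f h ∈ S) → P S → P (insert f S))
    {S : Set (Under i)} (hS : IsCosieve S) : P S := by
  obtain ⟨deg, hdeg⟩ := IsInverse.exists_deg (I := I)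
  induction hn : S.ncard generalizing S with
  | zero =>
    rw [Set.ncard_eq_zero] at hn
    rwa [hn]
  | succ n ih =>
    have hne : S.Nonempty := by
      rw [← Set.ncard_pos, hn]
      omega
    -- A non-identity map from another element of `S` to `f` would start at an object of larger
    -- degree. By maximality there is none, so `f` can be removed.
    obtain ⟨f, hf, hmax⟩ := Set.exists_max_image S (fun f => deg f.right) (Set.toFinite S) hne
    have hS' : IsCosieve (S \ {f}) := by
      rintro g g' u ⟨hg, hgf⟩
      refine ⟨hS u hg, fun h => ?_⟩
      obtain rfl : g' = f := h
      by_cases hu : Under.mk u.right = Under.mk (𝟙 g.right)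
      · exact hgf (eq_of_underMk_right_eq_id u hu)
      · exact absurd (hdeg u.right hu) (not_lt.mpr (hmax g hg))
    have h := h₁ f (S \ {f}) (fun h => h.2 rfl) hS' (fun h => ⟨hS (toExtend f h) hf, fun e => by
      have hlt : deg (extend f h).right < deg f.right := hdeg h.obj.hom h.property
      rw [show extend f h = f from e] at hlt
      exact lt_irrefl _ hlt⟩) (ih hS' (by rw [Set.ncard_sdiff_singleton_of_mem hf, hn]; rfl))
    rwa [Set.insert_sdiff_singleton, Set.insert_eq_of_mem hf] at h

/-- A non-identity endomorphism would lower the degree of its own source. -/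
theorem hom_right_eq_id [IsInverse I] {i : I} {f : Under i} (g : f ⟶ f) : g = 𝟙 f := by
  obtain ⟨deg, hdeg⟩ := IsInverse.exists_deg (I := I)
  by_cases h : Under.mk g.right = Under.mk (𝟙 f.right)
  · obtain ⟨e, he⟩ := eq_of_underMk_eq_id h
    ext
    simpa using he
  · exact absurd (hdeg _ h) (lt_irrefl _)

theorem isCosieve_univ (i : I) : IsCosieve (Set.univ : Set (Under i)) := fun _ _ _ _ => trivial

/-- If a non-identity `f : i ⟶ j` followed by `u : j ⟶ i` were the identity, the degree would drop
along `f` and not recover along `u`. -/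
theorem isCosieve_boundary [IsInverse I] (i : I) :
    IsCosieve {f : Under i | f ≠ Under.mk (𝟙 i)} := by
  rintro f g u hf rfl
  obtain ⟨deg, hdeg⟩ := IsInverse.exists_deg (I := I)
  have h₁ := hdeg f.hom hf
  by_cases h : Under.mk u.right = Under.mk (𝟙 f.right)
  · exact hf (eq_of_underMk_right_eq_id u h)
  · exact lt_asymm h₁ (hdeg u.right h)

end Cosieves

/-! ### Natural families on a cosieve, and adding one map to the cosieve. -/

section Sections

variable {I : Type u₁} [Category.{v₁} I] {C : Type u₂} [Category.{v₂} C]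

/-- A diagram `q : tot ⟶ base` on `i/I` over `B`, with a cone on `base` with vertex `Z`. -/
structure Shape (B : I ⥤ C) (i : I) (Z : C) where
  /-- the target of `q` -/
  base : Under i ⥤ C
  /-- the source of `q` -/
  tot : Under i ⥤ C
  /-- the cone with vertex `Z` -/
  a : ∀ f : Under i, Z ⟶ base.obj f
  a_map : ∀ {f f' : Under i} (g : f ⟶ f'), a f ≫ base.map g = a f'
  /-- the map of diagrams `tot ⟶ base` -/
  q : ∀ f : Under i, tot.obj f ⟶ base.obj f
  q_map : ∀ {f f' : Under i} (g : f ⟶ f'), tot.map g ≫ q f' = q f ≫ base.map g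
  /-- the map of diagrams from `tot` to the restriction of `B` -/
  b : ∀ f : Under i, tot.obj f ⟶ B.obj f.right
  b_map : ∀ {f f' : Under i} (g : f ⟶ f'), tot.map g ≫ b f' = b f ≫ B.map g.right

theorem Shape.condition_map {B : I ⥤ C} {i : I} {Z : C} (D : Shape B i Z) {f f' : Under i}
    (g : f ⟶ f') {T V : C} {t : T ⟶ Z} {x : V ⟶ T} {y : V ⟶ D.tot.obj f}
    (h : x ≫ t ≫ D.a f = y ≫ D.q f) : x ≫ t ≫ D.a f' = (y ≫ D.tot.map g) ≫ D.q f' := by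
  rw [← D.a_map g, Category.assoc, D.q_map, ← reassoc_of% h]

variable [HasFiniteLimits C]

/-- Natural families of maps `T ×_{base f} tot f ⟶ X_j` over `B_j`, for `f : i ⟶ j` in `S`. -/
@[ext]
structure Sec {B X : I ⥤ C} {i : I} {Z : C} (D : Shape B i Z) (k : X ⟶ B) (S : Set (Under i))
    {T : C} (t : T ⟶ Z) where
  /-- the component at `f : i ⟶ j` -/
  val : ∀ f ∈ S, HomSec (D.a f) (D.q f) (D.b f) (k.app f.right) t
  natural : ∀ {f f' : Under i} (hf : f ∈ S) (hf' : f' ∈ S) (g : f ⟶ f') {V : C} (x : V ⟶ T)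
    (y : V ⟶ D.tot.obj f) (h : x ≫ t ≫ D.a f = y ≫ D.q f),
    (val f hf).eval x y h ≫ X.map g.right =
      (val f' hf').eval x (y ≫ D.tot.map g) (D.condition_map g h)

/-- The presheaf of natural families of maps `T ×_{base f} tot f ⟶ X_j` over `B_j`, for
`f : i ⟶ j` in `S`. -/
noncomputable abbrev secPsh {B X : I ⥤ C} {i : I} {Z : C} (D : Shape B i Z) (k : X ⟶ B)
    (S : Set (Under i)) : Psh.{v₂, u₂, max u₁ v₁ v₂} Z where
  obj t := Sec D k S t
  res v h s :=
    { val := fun f hf => (s.val f hf).res v h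
      natural := fun hf hf' g V x y h => by
        rw [HomSec.eval_res, HomSec.eval_res, s.natural hf hf' g] }
  res_id s := by
    ext f hf : 3
    exact (homPsh _ _ _ _).res_id (s.val f hf)
  res_res v h v' h' s := by
    ext f hf : 3
    exact (homPsh _ _ _ _).res_res v h v' h' (s.val f hf)

variable {B X : I ⥤ C} {i : I} {Z : C} (D : Shape B i Z) (k : X ⟶ B)

/-- The component at `f`. -/
noncomputable def secEval {S : Set (Under i)} (f : Under i) (hf : f ∈ S) :
    PshMap (secPsh D k S) (homPsh (D.a f) (D.q f) (D.b f) (k.app f.right)) where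
  app s := s.val f hf
  app_res _ _ _ := rfl

/-- Restriction to a smaller cosieve. -/
noncomputable def secRestrict {S S' : Set (Under i)} (hS : S' ⊆ S) :
    PshMap (secPsh D k S) (secPsh D k S') where
  app s :=
    { val := fun f hf => s.val f (hS hf)
      natural := fun hf hf' g => s.natural (hS hf) (hS hf') g }
  app_res _ _ _ := rfl

/-- There is exactly one empty family, so the presheaf is terminal on the slice. -/
theorem isRep_sec_empty : ∃ x : (secPsh D k ∅).obj (𝟙 Z), IsRep (secPsh D k ∅) (𝟙 Z) x := by
  refine ⟨⟨fun _ h => h.elim, fun h => h.elim⟩, fun t s => ⟨t, Category.comp_id t, ?_⟩,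
    fun h h' _ => ?_⟩
  · ext g hg : 3
    exact hg.elim
  · exact (Category.comp_id _).symm.trans ((h.trans h'.symm).trans (Category.comp_id _))

section

variable {D k} {S : Set (Under i)} {T : C} {t : T ⟶ Z} (s : Sec D k S t) (f : Under i)
  (hf : ∀ h : Boundary f.right, extend f h ∈ S)

/-- The value of a natural family at the composite of `f` with a non-identity map. -/
noncomputable def Sec.extendVal (h : Boundary f.right) {V : C} (x : V ⟶ T)
    (y : V ⟶ D.tot.obj f) (hxy : x ≫ t ≫ D.a f = y ≫ D.q f) : V ⟶ X.obj h.obj.right :=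
  (s.val _ (hf h)).eval x (y ≫ D.tot.map (toExtend f h)) (D.condition_map _ hxy)

/-- With `Sec.extendVal_app`, this is the compatibility under which the values at the composites of
`f` assemble into a map to the relative matching object. -/
theorem Sec.extendVal_map {h h' : Boundary f.right} (φ : h ⟶ h') {V : C} (x : V ⟶ T)
    (y : V ⟶ D.tot.obj f) (hxy : x ≫ t ≫ D.a f = y ≫ D.q f) :
    s.extendVal f hf h x y hxy ≫ X.map φ.hom.right = s.extendVal f hf h' x y hxy := by
  refine (s.natural (hf h) (hf h') (extendMap f φ) _ _ _).trans ?_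
  exact HomSec.eval_congr _ rfl (by
    rw [Category.assoc, ← D.tot.map_comp, toExtend_comp_extendMap]) _

theorem Sec.extendVal_app (h : Boundary f.right) {V : C} (x : V ⟶ T)
    (y : V ⟶ D.tot.obj f) (hxy : x ≫ t ≫ D.a f = y ≫ D.q f) :
    s.extendVal f hf h x y hxy ≫ k.app h.obj.right = (y ≫ D.b f) ≫ B.map h.obj.hom := by
  refine (HomSec.eval_over _ _ _ _).trans ?_
  rw [Category.assoc, D.b_map, Category.assoc]
  rfl

theorem Sec.comp_extendVal (h : Boundary f.right) {V V' : C} (z : V' ⟶ V) (x : V ⟶ T)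
    (y : V ⟶ D.tot.obj f) (hxy : x ≫ t ≫ D.a f = y ≫ D.q f) :
    z ≫ s.extendVal f hf h x y hxy = s.extendVal f hf h (z ≫ x) (z ≫ y)
      (by rw [Category.assoc, hxy, Category.assoc]) :=
  (HomSec.comp_eval _ _ _ _ _).trans (HomSec.eval_congr _ rfl (Category.assoc _ _ _).symm _)

end

variable [∀ i : I, Finite (Under i)]

/-- The projections of a matching object. -/
noncomputable def matchingπ (X : I ⥤ C) (j : I) (h : Boundary j) :
    matchingObj X j ⟶ X.obj h.obj.right :=
  limit.π (boundaryForget j ⋙ X) h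

theorem matchingObj_hom_ext {X : I ⥤ C} {j : I} {V : C} {u v : V ⟶ matchingObj X j}
    (h : ∀ f : Boundary j, u ≫ matchingπ X j f = v ≫ matchingπ X j f) : u = v :=
  limit.hom_ext h

/-- The map to a matching object given by a compatible family of maps. -/
noncomputable def matchingLift {X : I ⥤ C} {j : I} {V : C}
    (u : ∀ h : Boundary j, V ⟶ X.obj h.obj.right)
    (hu : ∀ (h h' : Boundary j) (φ : h ⟶ h'), u h ≫ X.map φ.hom.right = u h') :
    V ⟶ matchingObj X j :=
  limit.lift (boundaryForget j ⋙ X)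
    { pt := V
      π := { app := u
             naturality := fun _ _ φ => (Category.id_comp _).trans (hu _ _ φ).symm } }

theorem matchingLift_π {X : I ⥤ C} {j : I} {V : C}
    (u : ∀ h : Boundary j, V ⟶ X.obj h.obj.right)
    (hu : ∀ (h h' : Boundary j) (φ : h ⟶ h'), u h ≫ X.map φ.hom.right = u h')
    (h : Boundary j) : matchingLift u hu ≫ matchingπ X j h = u h :=
  limit.lift_π _ _

theorem matchingMap_π (X : I ⥤ C) (j : I) (h : Boundary j) :
    matchingMap X j ≫ matchingπ X j h = X.map h.obj.hom :=
  limit.lift_π _ _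

theorem matchingObjMap_π {X Y : I ⥤ C} (φ : X ⟶ Y) (j : I) (h : Boundary j) :
    matchingObjMap φ j ≫ matchingπ Y j h = matchingπ X j h ≫ φ.app h.obj.right :=
  limMap_π _ _

theorem matchingπ_map (X : I ⥤ C) (j : I) {h h' : Boundary j} (φ : h ⟶ h') :
    matchingπ X j h ≫ X.map φ.hom.right = matchingπ X j h' :=
  limit.w (boundaryForget j ⋙ X) φ

/-- The object `B_j ×_{M_j B} M_j X`. -/
noncomputable abbrev relMatchingObj (j : I) : C :=
  pullback (matchingMap B j) (matchingObjMap k j)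

/-- The projection `B_j ×_{M_j B} M_j X ⟶ B_j`. -/
noncomputable abbrev relMatchingFst (j : I) : relMatchingObj k j ⟶ B.obj j :=
  pullback.fst _ _

/-- The projection `B_j ×_{M_j B} M_j X ⟶ X_h` for a non-identity map `h` out of `j`. -/
noncomputable def relMatchingπ (j : I) (h : Boundary j) :
    relMatchingObj k j ⟶ X.obj h.obj.right :=
  pullback.snd _ _ ≫ matchingπ X j h

variable {k}

theorem relMatchingObj_hom_ext {j : I} {V : C} {u v : V ⟶ relMatchingObj k j}
    (h₁ : u ≫ relMatchingFst k j = v ≫ relMatchingFst k j)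
    (h₂ : ∀ h : Boundary j, u ≫ relMatchingπ k j h = v ≫ relMatchingπ k j h) : u = v :=
  pullback.hom_ext h₁ (matchingObj_hom_ext fun h => by
    simpa only [relMatchingπ, Category.assoc] using h₂ h)

theorem relMatchingMap_fst (j : I) : relMatchingMap k j ≫ relMatchingFst k j = k.app j :=
  pullback.lift_fst _ _ _

theorem relMatchingMap_π (j : I) (h : Boundary j) :
    relMatchingMap k j ≫ relMatchingπ k j h = X.map h.obj.hom := by
  rw [relMatchingMap, relMatchingπ, pullback.lift_snd_assoc, matchingMap_π]

theorem relMatchingπ_map (j : I) {h h' : Boundary j} (φ : h ⟶ h') :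
    relMatchingπ k j h ≫ X.map φ.hom.right = relMatchingπ k j h' := by
  rw [relMatchingπ, Category.assoc, matchingπ_map, relMatchingπ]

theorem relMatchingπ_app (j : I) (h : Boundary j) :
    relMatchingπ k j h ≫ k.app _ = relMatchingFst k j ≫ B.map h.obj.hom := by
  rw [relMatchingπ, Category.assoc, ← matchingObjMap_π, ← pullback.condition_assoc, matchingMap_π]

/-- The map to `B_j ×_{M_j B} M_j X` given by a map to `B_j` and a compatible family of maps to
the objects `X_h`. -/
noncomputable def relMatchingLift {j : I} {V : C} (b : V ⟶ B.obj j)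
    (u : ∀ h : Boundary j, V ⟶ X.obj h.obj.right)
    (hu : ∀ (h h' : Boundary j) (φ : h ⟶ h'), u h ≫ X.map φ.hom.right = u h')
    (hb : ∀ h : Boundary j, u h ≫ k.app _ = b ≫ B.map h.obj.hom) :
    V ⟶ relMatchingObj k j :=
  pullback.lift b (matchingLift u hu) (matchingObj_hom_ext fun h => by
    rw [Category.assoc, Category.assoc, matchingMap_π, matchingObjMap_π, ← Category.assoc,
      matchingLift_π, hb])

theorem relMatchingLift_fst {j : I} {V : C} (b : V ⟶ B.obj j)
    (u : ∀ h : Boundary j, V ⟶ X.obj h.obj.right)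
    (hu : ∀ (h h' : Boundary j) (φ : h ⟶ h'), u h ≫ X.map φ.hom.right = u h')
    (hb : ∀ h : Boundary j, u h ≫ k.app _ = b ≫ B.map h.obj.hom) :
    relMatchingLift b u hu hb ≫ relMatchingFst k j = b :=
  pullback.lift_fst _ _ _

theorem relMatchingLift_π {j : I} {V : C} (b : V ⟶ B.obj j)
    (u : ∀ h : Boundary j, V ⟶ X.obj h.obj.right)
    (hu : ∀ (h h' : Boundary j) (φ : h ⟶ h'), u h ≫ X.map φ.hom.right = u h')
    (hb : ∀ h : Boundary j, u h ≫ k.app _ = b ≫ B.map h.obj.hom) (h : Boundary j) :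
    relMatchingLift b u hu hb ≫ relMatchingπ k j h = u h := by
  rw [relMatchingLift, relMatchingπ, pullback.lift_snd_assoc, matchingLift_π]

variable (k)

section

variable {D k} {S : Set (Under i)} {T : C} {t : T ⟶ Z} (s : Sec D k S t) (f : Under i)
  (hf : ∀ h : Boundary f.right, extend f h ∈ S)

/-- The map `T ×_{base f} tot f ⟶ B_j ×_{M_j B} M_j X` given by a natural family on a set of maps
containing all the composites of `f : i ⟶ j` with non-identity maps. -/
noncomputable def Sec.matching : HomSec (D.a f) (D.q f) (D.b f) (relMatchingFst k f.right) t where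
  hom := relMatchingLift (pullback.snd _ _ ≫ D.b f)
    (fun h => s.extendVal f hf h (pullback.fst _ _) (pullback.snd _ _) pullback.condition)
    (fun _ _ φ => s.extendVal_map f hf φ _ _ _) (fun h => s.extendVal_app f hf h _ _ _)
  hom_comp := relMatchingLift_fst _ _ _ _

theorem Sec.eval_matching_π {V : C} (x : V ⟶ T)
    (y : V ⟶ D.tot.obj f) (hxy : x ≫ t ≫ D.a f = y ≫ D.q f) (h : Boundary f.right) :
    (s.matching f hf).eval x y hxy ≫ relMatchingπ k f.right h = s.extendVal f hf h x y hxy := by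
  rw [HomSec.eval, Category.assoc, matching, relMatchingLift_π, Sec.comp_extendVal]
  congr 1
  · exact pullback.lift_fst _ _ _
  · exact pullback.lift_snd _ _ _

end

/-- The map `T ×_{base f} tot f ⟶ B_j ×_{M_j B} M_j X` given by a natural family, as a map of
presheaves. -/
noncomputable def secMatching {S : Set (Under i)} (f : Under i)
    (hf : ∀ h : Boundary f.right, extend f h ∈ S) :
    PshMap (secPsh D k S) (homPsh (D.a f) (D.q f) (D.b f) (relMatchingFst k f.right)) where
  app s := s.matching f hf
  app_res v hv s := by
    refine HomSec.ext_eval fun x y hxy => relMatchingObj_hom_ext ?_ fun h => ?_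
    · rw [HomSec.eval_over, HomSec.eval_over]
    · rw [Sec.eval_matching_π, homPsh.eval_res, Sec.eval_matching_π]
      exact HomSec.eval_res v hv _ _ _ _

/-- Adding a map to a cosieve amounts to lifting along a relative matching map. -/
theorem pshPullback_sec [IsInverse I] {S : Set (Under i)} (f : Under i) (hfS : f ∉ S)
    (hS : IsCosieve S) (hf : ∀ h : Boundary f.right, extend f h ∈ S) :
    PshPullback (secRestrict D k (Set.subset_insert f S)) (secEval D k f (Set.mem_insert f S))
      (secMatching D k f hf) (homPsh.postcomp (D.a f) (D.q f) (D.b f) (relMatchingMap k f.right)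
        (relMatchingMap_fst f.right)) where
  comm s := by
    refine HomSec.ext_eval fun x y hxy => relMatchingObj_hom_ext ?_ fun h => ?_
    · rw [HomSec.eval_over, HomSec.eval_over]
    · refine (Sec.eval_matching_π _ _ _ _ _ _ _).trans (Eq.symm ?_)
      refine (congrArg (· ≫ relMatchingπ k f.right h) (HomSec.eval_postcomp _
        (relMatchingMap_fst f.right) (s.val f (Set.mem_insert f S)) x y hxy)).trans ?_
      rw [Category.assoc, relMatchingMap_π]
      exact s.natural (Set.mem_insert f S) (Set.mem_insert_of_mem f (hf h)) (toExtend f h) x y hxy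
  lift {T t} s u hsu := by
    -- The extended family is the old one on `S` and `u` at `f`. The type of a component depends on
    -- the map, so the value at `f` is specified through a transport.
    have H : ∀ g ∈ insert f S, ∃ w : HomSec (D.a g) (D.q g) (D.b g) (k.app g.right) t,
        (∀ hg : g ∈ S, w = s.val g hg) ∧ (∀ e : f = g, w = e ▸ u) := by
      intro g hg
      by_cases hgS : g ∈ S
      · exact ⟨s.val g hgS, fun _ => rfl, fun e => absurd (e ▸ hgS) hfS⟩
      · obtain rfl := hg.resolve_right hgS
        exact ⟨u, fun h => absurd h hgS, fun _ => rfl⟩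
    choose w hwS hwf using H
    have hu : ∀ {V : C} (x : V ⟶ T) (y : V ⟶ D.tot.obj f) (hxy : x ≫ t ≫ D.a f = y ≫ D.q f)
        (h : Boundary f.right), HomSec.eval u x y hxy ≫ X.map h.obj.hom =
          s.extendVal f hf h x y hxy := by
      intro V x y hxy h
      rw [← s.eval_matching_π f hf, ← relMatchingMap_π, ← Category.assoc,
        ← HomSec.eval_postcomp _ (relMatchingMap_fst f.right)]
      exact congrArg (· ≫ relMatchingπ k f.right h)
        (congrArg (fun o => HomSec.eval o x y hxy) hsu.symm)
    refine ⟨⟨w, ?_⟩, ?_, hwf f _ rfl⟩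
    · intro g g' hg hg' φ V x y h
      -- Naturality along `φ : g ⟶ g'`: if `g` is in `S` then so is `g'`; if only `g` is the new
      -- map, it is the lifting equation `hu`; if both are, `φ` is an identity.
      by_cases hgS : g ∈ S
      · rw [hwS g hg hgS, hwS g' hg' (hS φ hgS)]
        exact s.natural _ _ _ _ _ _
      · obtain rfl := hg.resolve_right hgS
        by_cases hgS' : g' ∈ S
        · rw [hwS g' hg' hgS', hwf _ hg rfl]
          have hφ : Under.mk φ.right ≠ Under.mk (𝟙 g.right) := fun e =>
            hgS (eq_of_underMk_right_eq_id φ e ▸ hgS')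
          let b : Boundary g.right := ⟨Under.mk φ.right, hφ⟩
          -- The composite of `g` with `φ.right` equals `g'` only propositionally; naturality along
          -- `ψ`, whose underlying map is an identity, avoids a transport.
          let ψ : extend g b ⟶ g' := Under.homMk (𝟙 g'.right)
            ((Category.comp_id _).trans (Under.w φ))
          refine (hu x y h b).trans ?_
          have := s.natural (hf b) hgS' ψ x (y ≫ D.tot.map (toExtend g b)) (D.condition_map _ h)
          rw [show ψ.right = 𝟙 _ from rfl, X.map_id] at this
          refine (Category.comp_id _).symm.trans (this.trans (HomSec.eval_congr _ rfl ?_ _))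
          rw [Category.assoc, ← D.tot.map_comp]
          congr 2
          ext
          exact Category.comp_id _
        · obtain rfl := hg'.resolve_right hgS'
          rw [hom_right_eq_id φ, Under.id_right, X.map_id, Category.comp_id]
          exact HomSec.eval_congr _ rfl (by rw [D.tot.map_id, Category.comp_id]) _
    · ext g hg : 3
      exact hwS g _ hg
  ext {T t s s'} h₁ h₂ := by
    ext g hg : 3
    by_cases hgS : g ∈ S
    · exact congrFun (congrFun (congrArg Sec.val h₁) g) hgS
    · obtain rfl := hg.resolve_right hgS
      exact h₂

variable {Fib : MorphismProperty C} [Fib.IsStableUnderBaseChange]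

/-- The representing objects for a cosieve and for a smaller cosieve, with the map between them. -/
theorem exists_isRep_sec_insert [IsInverse I] (hFib : FibrationsStableUnderPushforward Fib)
    (hk : IsReedyFibration Fib k) {S : Set (Under i)} (f : Under i) (hfS : f ∉ S)
    (hS : IsCosieve S) (hf : ∀ h : Boundary f.right, extend f h ∈ S) (hq : Fib (D.q f))
    {R : C} {r : R ⟶ Z} {x : (secPsh D k S).obj r} (hR : IsRep (secPsh D k S) r x) :
    ∃ (E : C) (e : E ⟶ R) (y : (secPsh D k (insert f S)).obj (e ≫ r)),
      IsRep (secPsh D k (insert f S)) (e ≫ r) y ∧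
        IsRepMap (secRestrict D k (Set.subset_insert f S)) y x e ∧ Fib e :=
  (pshPullback_sec D k f hfS hS hf).exists_isRep hFib hR (hk f.right) hq

variable [Fib.IsMultiplicative]

/-- Each map added to the cosieve contributes one fibration, so the structure map is a finite
composite of fibrations. -/
theorem exists_isRep_sec [IsInverse I] (hFib : FibrationsStableUnderPushforward Fib)
    (hk : IsReedyFibration Fib k) (hq : ∀ f, Fib (D.q f)) {S : Set (Under i)}
    (hS : IsCosieve S) :
    ∃ (R : C) (r : R ⟶ Z) (x : (secPsh D k S).obj r), IsRep (secPsh D k S) r x ∧ Fib r := by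
  refine cosieve_induction (P := fun S => ∃ (R : C) (r : R ⟶ Z) (x : (secPsh D k S).obj r),
    IsRep (secPsh D k S) r x ∧ Fib r) ?_ (fun f S hfS hS hf ⟨R, r, x, hx, hr⟩ => ?_) hS
  · obtain ⟨x, hx⟩ := isRep_sec_empty D k
    exact ⟨Z, 𝟙 Z, x, hx, Fib.id_mem _⟩
  · obtain ⟨E, e, y, hy, -, he⟩ := exists_isRep_sec_insert D k hFib hk f hfS hS hf (hq f) hx
    exact ⟨E, e ≫ r, y, hy, Fib.comp_mem _ _ he hr⟩

/-- A map from a representing object for a cosieve to one for a cosieve with one map less is a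
fibration. -/
theorem fib_of_isRepMap_secRestrict [IsInverse I] (hFib : FibrationsStableUnderPushforward Fib)
    (hk : IsReedyFibration Fib k) {S : Set (Under i)} (f : Under i) (hfS : f ∉ S)
    (hS : IsCosieve S) (hf : ∀ h : Boundary f.right, extend f h ∈ S) (hq : Fib (D.q f))
    {R : C} {r : R ⟶ Z} {x : (secPsh D k S).obj r} (hR : IsRep (secPsh D k S) r x)
    {E : C} {e : E ⟶ Z} {y : (secPsh D k (insert f S)).obj e}
    (hE : IsRep (secPsh D k (insert f S)) e y) {d : E ⟶ R}
    (hd : IsRepMap (secRestrict D k (Set.subset_insert f S)) y x d) : Fib d := by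
  -- The constructed representing object has the property, and any other is isomorphic to it
  -- compatibly with the restriction map.
  obtain ⟨E', e', y', hE', he', hfib⟩ := exists_isRep_sec_insert D k hFib hk f hfS hS hf hq hR
  obtain ⟨ε, hε, hεy⟩ := hE.exists_iso hE'
  have : ε.hom ≫ e' = d := by
    refine hR.inj (t := e) (by rw [Category.assoc, he'.1, hε]) hd.1 ?_
    rw [he'.res ε.hom hε, hεy, hd.2]
  rw [← this]
  exact Fib.comp_mem _ _ (Fib.of_isIso _) hfib

end Sections

/-! ### Pushforwards of diagrams as objects representing natural families. -/

section PointwisePushforward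

variable {I : Type u₁} [Category.{v₁} I] {C : Type u₂} [Category.{v₂} C]

/-- The shape given by the restriction of `p : B ⟶ A` to `i/I`, with vertex `A_i`. -/
abbrev Shape.ofHom {B A : I ⥤ C} (p : B ⟶ A) (i : I) : Shape B i (A.obj i) where
  base :=
    { obj := fun f => A.obj f.right
      map := fun g => A.map g.right }
  tot :=
    { obj := fun f => B.obj f.right
      map := fun g => B.map g.right }
  a f := A.map f.hom
  a_map g := by rw [← A.map_comp, Under.w]
  q f := p.app f.right
  q_map g := p.naturality _
  b f := 𝟙 _
  b_map g := by rw [Category.comp_id, Category.id_comp]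

theorem IsRep.of_iso {Z R R' : C} {F : Psh.{v₂, u₂, w} Z} {r : R ⟶ Z} {x : F.obj r}
    (hR : IsRep F r x) {r' : R' ⟶ Z} {x' : F.obj r'} (e : R' ≅ R) (h : e.hom ≫ r = r')
    (hx : F.res e.hom h x = x') : IsRep F r' x' where
  surj t s := by
    obtain ⟨v, hv, hvs⟩ := hR.surj t s
    refine ⟨v ≫ e.inv, by rw [← h, Category.assoc, e.inv_hom_id_assoc, hv], ?_⟩
    rw [← hx, F.res_res, ← hvs]
    congr 1
    rw [Category.assoc, e.inv_hom_id, Category.comp_id]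
  inj {T t v v'} hv hv' H := by
    rw [← hx, F.res_res, F.res_res] at H
    have := hR.inj _ _ H
    rwa [cancel_mono] at this

variable [HasFiniteLimits C] {B A X : I ⥤ C} {k : X ⟶ B} {p : B ⟶ A}

namespace Sec

/-- The value at `u : i ⟶ j` of a natural family on all of `i/I`. -/
noncomputable def ev {i : I} {T : C} {t : T ⟶ A.obj i}
    (s : Sec (Shape.ofHom p i) k Set.univ t) {j : I} (u : i ⟶ j) {V : C} (x : V ⟶ T)
    (y : V ⟶ B.obj j) (h : x ≫ t ≫ A.map u = y ≫ p.app j) : V ⟶ X.obj j :=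
  HomSec.eval (s.val (Under.mk u) trivial) x y h

variable {i : I} {T : C} {t : T ⟶ A.obj i} (s : Sec (Shape.ofHom p i) k Set.univ t)

theorem ev_app {j : I} (u : i ⟶ j) {V : C} (x : V ⟶ T) (y : V ⟶ B.obj j)
    (h : x ≫ t ≫ A.map u = y ≫ p.app j) : s.ev u x y h ≫ k.app j = y :=
  (HomSec.eval_over _ _ _ _).trans (Category.comp_id _)

theorem comp_ev {j : I} (u : i ⟶ j) {V V' : C} (z : V' ⟶ V) (x : V ⟶ T) (y : V ⟶ B.obj j)
    (h : x ≫ t ≫ A.map u = y ≫ p.app j) : z ≫ s.ev u x y h =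
      s.ev u (z ≫ x) (z ≫ y) (by rw [Category.assoc, h, Category.assoc]) :=
  HomSec.comp_eval _ _ _ _ _

theorem ev_map {j j' : I} (u : i ⟶ j) (g : j ⟶ j') {V : C} (x : V ⟶ T) (y : V ⟶ B.obj j)
    (h : x ≫ t ≫ A.map u = y ≫ p.app j) : s.ev u x y h ≫ X.map g =
      s.ev (u ≫ g) x (y ≫ B.map g) (by
        rw [A.map_comp, Category.assoc, p.naturality, ← reassoc_of% h]) :=
  s.natural (f := Under.mk u) (f' := Under.mk (u ≫ g)) trivial trivial (Under.homMk g) x y h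

theorem ev_congr {j : I} {u u' : i ⟶ j} (hu : u = u') {V : C} {x x' : V ⟶ T} (hx : x = x')
    {y y' : V ⟶ B.obj j} (hy : y = y') (h : x ≫ t ≫ A.map u = y ≫ p.app j) :
    s.ev u x y h = s.ev u' x' y' (by rw [← hu, ← hx, ← hy, h]) := by
  subst hu hx hy
  rfl

theorem ext_ev {s s' : Sec (Shape.ofHom p i) k Set.univ t}
    (H : ∀ {j : I} (u : i ⟶ j) {V : C} (x : V ⟶ T) (y : V ⟶ B.obj j)
      (h : x ≫ t ≫ A.map u = y ≫ p.app j), s.ev u x y h = s'.ev u x y h) : s = s' := by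
  ext f hf : 3
  exact HomSec.ext_eval fun x y h => H f.hom x y h

theorem ev_res {T' : C} {t' : T' ⟶ A.obj i} (v : T' ⟶ T) (hv : v ≫ t = t') {j : I} (u : i ⟶ j)
    {V : C} (x : V ⟶ T') (y : V ⟶ B.obj j) (h : x ≫ t' ≫ A.map u = y ≫ p.app j) :
    Sec.ev ((secPsh (Shape.ofHom p i) k Set.univ).res v hv s) u x y h =
      s.ev u (x ≫ v) y (by rw [Category.assoc, reassoc_of% hv, h]) :=
  HomSec.eval_res v hv _ _ _ _

end Sec

/-- A natural family of maps `T ×_{A_j} B_j ⟶ X_j` over `B_j`, for `i ⟶ j`, given by its values on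
generalized elements. -/
structure EvFamily (p : B ⟶ A) (k : X ⟶ B) {i : I} {T : C} (t : T ⟶ A.obj i) where
  /-- the value on a generalized element -/
  ev : ∀ {j : I} (u : i ⟶ j) {V : C} (x : V ⟶ T) (y : V ⟶ B.obj j),
    x ≫ t ≫ A.map u = y ≫ p.app j → (V ⟶ X.obj j)
  ev_app : ∀ {j : I} (u : i ⟶ j) {V : C} (x : V ⟶ T) (y : V ⟶ B.obj j)
    (h : x ≫ t ≫ A.map u = y ≫ p.app j), ev u x y h ≫ k.app j = y
  comp_ev : ∀ {j : I} (u : i ⟶ j) {V V' : C} (z : V' ⟶ V) (x : V ⟶ T) (y : V ⟶ B.obj j)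
    (h : x ≫ t ≫ A.map u = y ≫ p.app j),
    z ≫ ev u x y h = ev u (z ≫ x) (z ≫ y) (by rw [Category.assoc, h, Category.assoc])
  ev_map : ∀ {j j' : I} (u : i ⟶ j) (g : j ⟶ j') {V : C} (x : V ⟶ T) (y : V ⟶ B.obj j)
    (h : x ≫ t ≫ A.map u = y ≫ p.app j), ev u x y h ≫ X.map g =
      ev (u ≫ g) x (y ≫ B.map g) (by rw [A.map_comp, Category.assoc, p.naturality, ← reassoc_of% h])

namespace Sec

/-- A natural family given by its values on generalized elements. -/
noncomputable def ofEv {i : I} {T : C} {t : T ⟶ A.obj i} (E : EvFamily p k t) :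
    Sec (Shape.ofHom p i) k Set.univ t where
  val f _ :=
    { hom := E.ev f.hom (pullback.fst _ _) (pullback.snd _ _) pullback.condition
      hom_comp := (E.ev_app _ _ _ _).trans (Category.comp_id _).symm }
  natural {f f'} _ _ g V x y h := by
    simp only [HomSec.eval, E.comp_ev, E.ev_map]
    congr 1
    · exact Under.w g
    · rw [pullback.lift_fst, pullback.lift_fst]
    · rw [pullback.lift_snd, pullback.lift_snd]

theorem ev_ofEv {i : I} {T : C} {t : T ⟶ A.obj i} (E : EvFamily p k t) {j : I} (u : i ⟶ j)
    {V : C} (x : V ⟶ T) (y : V ⟶ B.obj j) (h : x ≫ t ≫ A.map u = y ≫ p.app j) :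
    (ofEv E).ev u x y h = E.ev u x y h := by
  refine (E.comp_ev _ _ _ _ _).trans ?_
  congr 1
  · exact pullback.lift_fst _ _ _
  · exact pullback.lift_snd _ _ _

variable {i : I} {T : C} {t : T ⟶ A.obj i} (s : Sec (Shape.ofHom p i) k Set.univ t)

/-- Restriction of a natural family along `g : i ⟶ j`. -/
noncomputable def shift {j : I} (g : i ⟶ j) :
    Sec (Shape.ofHom p j) k Set.univ (t ≫ A.map g) :=
  ofEv
    { ev := fun u _ x y h => s.ev (g ≫ u) x y (by rw [A.map_comp, ← h, Category.assoc])
      ev_app := fun _ _ _ _ _ => s.ev_app _ _ _ _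
      comp_ev := fun _ _ _ _ _ _ _ => s.comp_ev _ _ _ _ _
      ev_map := fun _ _ _ _ _ _ => (s.ev_map _ _ _ _ _).trans
        (s.ev_congr (Category.assoc _ _ _) rfl rfl _) }

theorem ev_shift {j : I} (g : i ⟶ j) {l : I} (u : j ⟶ l) {V : C} (x : V ⟶ T) (y : V ⟶ B.obj l)
    (h : x ≫ (t ≫ A.map g) ≫ A.map u = y ≫ p.app l) :
    (s.shift g).ev u x y h =
      s.ev (g ≫ u) x y (by rw [A.map_comp, ← h, Category.assoc]) :=
  ev_ofEv _ _ _ _ _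

end Sec

/-- The natural family at `i` determined by a map of diagrams `u : p^* T ⟶ X` over `B`. -/
noncomputable def pullbackSec {T Y : I ⥤ C} {t : T ⟶ A} {y : Y ⟶ T} {u : Y ⟶ X}
    (hp : IsPullback y (u ≫ k) t p) (i : I) : Sec (Shape.ofHom p i) k Set.univ (t.app i) :=
  Sec.ofEv
    { ev := fun {j} w _ x b h => (hp.app j).lift (x ≫ T.map w) b
        (by rw [Category.assoc, t.naturality, h]) ≫ u.app j
      ev_app := fun {j} w _ x b h => by
        rw [Category.assoc]
        exact (hp.app j).lift_snd _ _ _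
      comp_ev := fun {j} w _ _ z x b h => by
        rw [← Category.assoc]
        congr 1
        apply (hp.app j).hom_ext
        · rw [Category.assoc, IsPullback.lift_fst, IsPullback.lift_fst, Category.assoc]
        · rw [Category.assoc, IsPullback.lift_snd, IsPullback.lift_snd]
      ev_map := fun {j j'} w g _ x b h => by
        rw [Category.assoc, ← u.naturality, ← Category.assoc]
        congr 1
        apply (hp.app j').hom_ext
        · rw [IsPullback.lift_fst, Category.assoc, y.naturality, ← Category.assoc,
            IsPullback.lift_fst, T.map_comp, Category.assoc]
        · rw [IsPullback.lift_snd, Category.assoc, (u ≫ k).naturality, ← Category.assoc,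
            IsPullback.lift_snd] }

theorem ev_pullbackSec {T Y : I ⥤ C} {t : T ⟶ A} {y : Y ⟶ T} {u : Y ⟶ X}
    (hp : IsPullback y (u ≫ k) t p) (i : I) {j : I} (w : i ⟶ j) {V : C} (x : V ⟶ T.obj i)
    (b : V ⟶ B.obj j) (h : x ≫ t.app i ≫ A.map w = b ≫ p.app j) (l : V ⟶ Y.obj j)
    (hx : l ≫ y.app j = x ≫ T.map w) (hb : l ≫ (u ≫ k).app j = b) :
    (pullbackSec hp i).ev w x b h = l ≫ u.app j := by
  refine (Sec.ev_ofEv _ _ _ _ _).trans (congrArg (· ≫ u.app j) ?_)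
  apply (hp.app j).hom_ext
  · rw [IsPullback.lift_fst, hx]
  · rw [IsPullback.lift_snd, hb]

/-- Naturality in `T` of the passage from maps $p^*T\to X$ to natural families; it transports
universal elements between two pushforwards. -/
theorem pullbackSec_res {T T' Y Y' : I ⥤ C} {t : T ⟶ A} {y : Y ⟶ T} {u : Y ⟶ X}
    (hp : IsPullback y (u ≫ k) t p) {t' : T' ⟶ A} {y' : Y' ⟶ T'} {u' : Y' ⟶ X}
    (hp' : IsPullback y' (u' ≫ k) t' p) (v : T' ⟶ T) (hv : v ≫ t = t') (w : Y' ⟶ Y)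
    (hw : w ≫ y = y' ≫ v) (hwu : w ≫ u = u') (i : I) :
    (secPsh (Shape.ofHom p i) k Set.univ).res (v.app i) (NatTrans.congr_app hv i)
      (pullbackSec hp i) = pullbackSec hp' i := by
  refine Sec.ext_ev fun {j} g V z b h => ?_
  have hl : (z ≫ T'.map g) ≫ t'.app j = b ≫ p.app j := by
    rw [Category.assoc, t'.naturality, h]
  obtain ⟨l, hl₁, hl₂⟩ : ∃ l : V ⟶ Y'.obj j, l ≫ y'.app j = z ≫ T'.map g ∧
      l ≫ (u' ≫ k).app j = b :=
    ⟨(hp'.app j).lift _ _ hl, (hp'.app j).lift_fst _ _ _, (hp'.app j).lift_snd _ _ _⟩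
  rw [Sec.ev_res (pullbackSec hp i) (v.app i) (NatTrans.congr_app hv i) g z b h,
    ev_pullbackSec hp' i g z b h l hl₁ hl₂,
    ev_pullbackSec hp i g (z ≫ v.app i) b _ (l ≫ w.app j), Category.assoc,
    ← NatTrans.comp_app, hwu]
  · rw [Category.assoc, ← NatTrans.comp_app, hw, NatTrans.comp_app, ← Category.assoc, hl₁,
      Category.assoc, Category.assoc, v.naturality]
  · rw [Category.assoc, ← NatTrans.comp_app, reassoc_of% hwu, hl₂]

theorem IsRep.hom_ext_ev {i : I} {R : C} {r : R ⟶ A.obj i}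
    {x : Sec (Shape.ofHom p i) k Set.univ r} (hx : IsRep (secPsh (Shape.ofHom p i) k Set.univ) r x)
    {T : C} {t : T ⟶ A.obj i} {v v' : T ⟶ R} (hv : v ≫ r = t) (hv' : v' ≫ r = t)
    (H : ∀ {j : I} (u : i ⟶ j) {V : C} (z : V ⟶ T) (y : V ⟶ B.obj j)
      (h : z ≫ t ≫ A.map u = y ≫ p.app j),
      x.ev u (z ≫ v) y (by rw [Category.assoc, reassoc_of% hv, h]) =
        x.ev u (z ≫ v') y (by rw [Category.assoc, reassoc_of% hv', h])) : v = v' :=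
  hx.inj hv hv' (Sec.ext_ev fun u V z y h => by
    rw [Sec.ev_res x v hv u z y h, Sec.ev_res x v' hv' u z y h, H u z y h])

section RepDiagram

variable {R : I → C} {r : ∀ i, R i ⟶ A.obj i} {x : ∀ i, Sec (Shape.ofHom p i) k Set.univ (r i)}
  (hx : ∀ i, IsRep (secPsh (Shape.ofHom p i) k Set.univ) (r i) (x i))

/-- The functoriality of the objects representing natural families. -/
noncomputable def repMap {i j : I} (g : i ⟶ j) : R i ⟶ R j :=
  ((hx j).surj (r i ≫ A.map g) ((x i).shift g)).choose

theorem repMap_comp {i j : I} (g : i ⟶ j) : repMap hx g ≫ r j = r i ≫ A.map g :=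
  ((hx j).surj (r i ≫ A.map g) ((x i).shift g)).choose_spec.choose

theorem ev_repMap {i j l : I} (g : i ⟶ j) (u : j ⟶ l) {V : C} (z : V ⟶ R i) (y : V ⟶ B.obj l)
    (h : z ≫ r i ≫ A.map (g ≫ u) = y ≫ p.app l) :
    (x j).ev u (z ≫ repMap hx g) y (by
      rw [Category.assoc, ← Category.assoc (repMap hx g), repMap_comp, Category.assoc,
        ← A.map_comp, h]) = (x i).ev (g ≫ u) z y h := by
  have h' : z ≫ (r i ≫ A.map g) ≫ A.map u = y ≫ p.app l := by
    rw [Category.assoc, ← A.map_comp, h]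
  have hs := ((hx j).surj (r i ≫ A.map g) ((x i).shift g)).choose_spec.choose_spec
  rw [← Sec.ev_res (x j) _ (repMap_comp hx g) u z y h', ← Sec.ev_shift (x i) g u z y h']
  exact congrArg (fun s : Sec (Shape.ofHom p j) k Set.univ (r i ≫ A.map g) => s.ev u z y h') hs

/-- The diagram of objects representing the natural families. -/
noncomputable abbrev repDiagram : I ⥤ C where
  obj := R
  map g := repMap hx g
  map_id i := by
    refine (hx i).hom_ext_ev (t := r i) ?_ (Category.id_comp _) fun u V z y h => ?_
    · rw [repMap_comp, A.map_id, Category.comp_id]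
    · rw [ev_repMap hx (𝟙 i) u z y (by rw [Category.id_comp, h])]
      exact (x i).ev_congr (Category.id_comp _) (Category.comp_id _).symm rfl _
  -- Both maps have the value of the universal family at `g ≫ g' ≫ u`, and values separate maps into
  -- a representing object.
  map_comp {i j l} g g' := by
    refine (hx l).hom_ext_ev (t := r i ≫ A.map (g ≫ g')) (repMap_comp hx _) ?_
      fun u V z y h => ?_
    · rw [Category.assoc, repMap_comp, ← Category.assoc, repMap_comp, A.map_comp, Category.assoc]
    · have h₁ : z ≫ r i ≫ A.map (g ≫ g' ≫ u) = y ≫ p.app _ := by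
        rw [← h, Category.assoc, ← A.map_comp, Category.assoc]
      rw [ev_repMap hx (g ≫ g') u z y (by rw [Category.assoc, h₁]),
        (x l).ev_congr rfl (Category.assoc z (repMap hx g) (repMap hx g')).symm rfl,
        ev_repMap hx g' u (z ≫ repMap hx g) y (by
          rw [Category.assoc, ← Category.assoc (repMap hx g), repMap_comp, Category.assoc,
            ← A.map_comp, h₁]), ev_repMap hx g (g' ≫ u) z y h₁]
      exact (x i).ev_congr (Category.assoc _ _ _) rfl rfl _

/-- The map from the diagram of representing objects to `A`. -/
noncomputable abbrev repHom : repDiagram hx ⟶ A where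
  app := r
  naturality _ _ g := repMap_comp hx g

/-- The evaluation map of the diagram of representing objects. -/
noncomputable def repEv : pullback (repHom hx) p ⟶ X where
  app j := (x j).ev (𝟙 j) ((pullback.fst (repHom hx) p).app j) ((pullback.snd (repHom hx) p).app j)
    (by
      rw [A.map_id, Category.comp_id]
      exact NatTrans.congr_app (pullback.condition (f := repHom hx) (g := p)) j)
  naturality i j g := by
    rw [Sec.comp_ev, Sec.ev_map]
    have h : (pullback.fst (repHom hx) p).app i ≫ r i ≫ A.map (g ≫ 𝟙 j) =
        ((pullback.snd (repHom hx) p).app i ≫ B.map g) ≫ p.app j := by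
      rw [Category.comp_id, Category.assoc, p.naturality]
      exact (Category.assoc _ _ _).symm.trans ((congrArg (· ≫ A.map g) (NatTrans.congr_app
        (pullback.condition (f := repHom hx) (g := p)) i)).trans (Category.assoc _ _ _))
    refine Eq.trans ?_ ((ev_repMap hx g (𝟙 j) _ _ h).trans ?_)
    · exact (x j).ev_congr rfl ((pullback.fst (repHom hx) p).naturality g)
        ((pullback.snd (repHom hx) p).naturality g) _
    · exact (x i).ev_congr (by simp) rfl rfl _

theorem repEv_comp : repEv hx ≫ k = pullback.snd (repHom hx) p := by
  ext j
  exact Sec.ev_app _ _ _ _ _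

/-- A value of the evaluation map. -/
theorem comp_repEv {i j : I} (g : i ⟶ j) {V : C} (l : V ⟶ (pullback (repHom hx) p).obj j)
    (z : V ⟶ R i) (hl : l ≫ (pullback.fst (repHom hx) p).app j = z ≫ repMap hx g)
    (y : V ⟶ B.obj j) (hy : l ≫ (pullback.snd (repHom hx) p).app j = y)
    (h : z ≫ r i ≫ A.map g = y ≫ p.app j) :
    l ≫ (repEv hx).app j = (x i).ev g z y h := by
  refine (Sec.comp_ev _ _ _ _ _ _).trans (Eq.trans ((x j).ev_congr rfl hl hy _)
    ((ev_repMap hx g (𝟙 j) _ _ (by rw [Category.comp_id, h])).trans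
      ((x i).ev_congr (Category.comp_id _) rfl rfl _)))

theorem isPullback_repEv : IsPullback (pullback.fst (repHom hx) p) (repEv hx ≫ k)
    (repHom hx) p := by
  rw [repEv_comp]
  exact IsPullback.of_hasPullback _ _

/-- The diagram of representing objects is a pushforward. -/
noncomputable def repPushforward : Pushforward k p where
  obj := repDiagram hx
  hom := repHom hx
  pb := pullback (repHom hx) p
  proj := pullback.fst _ _
  ev := repEv hx
  isPullback := isPullback_repEv hx
  existsUnique_transpose {T Y} t y u hp := by
    -- The transpose is found objectwise; naturality and uniqueness follow by comparing values,
    -- which `hev` computes from `u`.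
    have hs := fun i => (hx i).surj (t.app i) (pullbackSec hp i)
    choose v hv hvs using hs
    have hev : ∀ {i j : I} (w : i ⟶ j) {V : C} (z : V ⟶ T.obj i) (b : V ⟶ B.obj j)
        (h : z ≫ t.app i ≫ A.map w = b ≫ p.app j) (l : V ⟶ Y.obj j)
        (_ : l ≫ y.app j = z ≫ T.map w) (_ : l ≫ (u ≫ k).app j = b),
        (x i).ev w (z ≫ v i) b (by rw [Category.assoc, reassoc_of% (hv i), h]) = l ≫ u.app j := by
      intro i j w V z b h l h₁ h₂
      rw [← ev_pullbackSec hp i w z b h l h₁ h₂, ← Sec.ev_res (x i) (v i) (hv i) w z b h]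
      exact congrArg (fun s : Sec (Shape.ofHom p i) k Set.univ (t.app i) => s.ev w z b h) (hvs i)
    have hlift : ∀ {i j : I} (w : i ⟶ j) {V : C} (z : V ⟶ T.obj i) (b : V ⟶ B.obj j)
        (h : z ≫ t.app i ≫ A.map w = b ≫ p.app j), ∃ l : V ⟶ Y.obj j,
          l ≫ y.app j = z ≫ T.map w ∧ l ≫ (u ≫ k).app j = b := by
      intro i j w V z b h
      have e : (z ≫ T.map w) ≫ t.app j = b ≫ p.app j := by rw [Category.assoc, t.naturality, h]
      exact ⟨(hp.app j).lift _ _ e, (hp.app j).lift_fst _ _ _, (hp.app j).lift_snd _ _ _⟩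
    let v' : T ⟶ repDiagram hx :=
      { app := v
        naturality := fun i j g => by
          refine (hx j).hom_ext_ev (t := t.app i ≫ A.map g)
            (by rw [Category.assoc, hv, t.naturality])
            (by
              change (v i ≫ repMap hx g) ≫ r j = _
              rw [Category.assoc, repMap_comp, reassoc_of% (hv i)]) fun {l} w V z b h => ?_
          change (x j).ev w (z ≫ T.map g ≫ v j) b _ = (x j).ev w (z ≫ v i ≫ repMap hx g) b _
          have h' : z ≫ t.app i ≫ A.map (g ≫ w) = b ≫ p.app l := by
            rw [A.map_comp, ← h, Category.assoc]
          have h'' : (z ≫ T.map g) ≫ t.app j ≫ A.map w = b ≫ p.app l := by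
            rw [Category.assoc, t.naturality_assoc, ← A.map_comp, h']
          -- By `hev`, both sides take the value of `u` at the element `m` of $p^*T$.
          obtain ⟨m, hm₁, hm₂⟩ := hlift (g ≫ w) z b h'
          rw [(x j).ev_congr rfl (Category.assoc z (v i) (repMap hx g)).symm rfl,
            ev_repMap hx g w (z ≫ v i) b (by rw [Category.assoc, reassoc_of% (hv i), h']),
            hev (g ≫ w) z b h' m hm₁ hm₂,
            (x j).ev_congr rfl (Category.assoc z (T.map g) (v j)).symm rfl,
            hev w (z ≫ T.map g) b h'' m (by rw [hm₁, T.map_comp, Category.assoc]) hm₂] }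
    have hv' : v' ≫ repHom hx = t := by
      ext i
      exact hv i
    have hw : (y ≫ v') ≫ repHom hx = (u ≫ k) ≫ p := by rw [Category.assoc, hv', hp.w]
    refine ⟨v', ⟨hv', pullback.lift (y ≫ v') (u ≫ k) hw, pullback.lift_fst _ _ _, ?_⟩, ?_⟩
    · ext j
      refine (comp_repEv hx (𝟙 j) _ (y.app j ≫ v j) ?_ _ ?_ ?_).trans ((hev (𝟙 j) (y.app j)
        ((u ≫ k).app j) ?_ (𝟙 _) ?_ ?_).trans (Category.id_comp _))
      · rw [show repMap hx (𝟙 j) = 𝟙 _ from (repDiagram hx).map_id j, Category.comp_id]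
        exact NatTrans.congr_app (pullback.lift_fst (y ≫ v') (u ≫ k) hw) j
      · exact NatTrans.congr_app (pullback.lift_snd (y ≫ v') (u ≫ k) hw) j
      · rw [A.map_id, Category.comp_id]
        exact NatTrans.congr_app hw j
      · rw [A.map_id, Category.comp_id]
        exact NatTrans.congr_app hp.w j
      · rw [T.map_id, Category.comp_id, Category.id_comp]
      · rw [Category.id_comp]
    · rintro v'' ⟨h₁, w, hw₁, hw₂⟩
      ext i
      refine (hx i).hom_ext_ev (t := t.app i)
        (show v''.app i ≫ r i = t.app i from NatTrans.congr_app h₁ i)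
        (hv i) fun {j} g V z b h => ?_
      obtain ⟨l, hl₁, hl₂⟩ := hlift g z b h
      refine Eq.trans ?_ (hev g z b h l hl₁ hl₂).symm
      have e : l ≫ u.app j = (l ≫ w.app j) ≫ (repEv hx).app j := by
        rw [← hw₂, NatTrans.comp_app, Category.assoc]
      refine Eq.trans ?_ e.symm
      refine (comp_repEv hx g _ _ ?_ _ ?_ _).symm
      · rw [Category.assoc, Category.assoc, ← NatTrans.comp_app, hw₁, NatTrans.comp_app,
          reassoc_of% hl₁, v''.naturality]
      · rw [Category.assoc, ← NatTrans.comp_app, ← repEv_comp, reassoc_of% hw₂, hl₂]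

/-- The family read off from the evaluation map of the constructed pushforward is the universal one,
so it is universal for this pushforward and, by transport, for any other. -/
theorem pullbackSec_repEv (i : I) : pullbackSec (isPullback_repEv hx) i = x i := by
  refine Sec.ext_ev fun {j} u V z y h => ?_
  have hp := (isPullback_repEv hx).app j
  have e : (z ≫ repMap hx u) ≫ r j = y ≫ p.app j := by
    rw [← h, Category.assoc, repMap_comp]
  refine (ev_pullbackSec (isPullback_repEv hx) i u z y h (hp.lift _ _ e)
    (hp.lift_fst _ _ _) (hp.lift_snd _ _ _)).trans ?_
  refine comp_repEv hx u _ z (hp.lift_fst _ _ _) y ?_ h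
  rw [← repEv_comp]
  exact hp.lift_snd _ _ _

/-- Every pushforward of diagrams consists of objects representing natural families. -/
theorem isRep_pullbackSec
    (hx : ∀ i, IsRep (secPsh (Shape.ofHom p i) k Set.univ) (r i) (x i)) (P : Pushforward k p)
    (i : I) :
    IsRep (secPsh (Shape.ofHom p i) k Set.univ) (P.hom.app i) (pullbackSec P.isPullback i) := by
  -- Two pushforwards are isomorphic over `A` compatibly with evaluation, so the universal families
  -- move from `P₀` to `P`.
  let P₀ := repPushforward hx
  let e : P.obj ⟶ P₀.obj := P₀.transpose P.hom P.proj P.ev P.isPullback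
  let d : P₀.obj ⟶ P.obj := P.transpose P₀.hom P₀.proj P₀.ev P₀.isPullback
  have he : e ≫ P₀.hom = P.hom := P₀.transpose_hom _ _ _ _
  have hd : d ≫ P.hom = P₀.hom := P.transpose_hom _ _ _ _
  obtain ⟨e', he₁, he₂⟩ := P₀.exists_transpose P.hom P.proj P.ev P.isPullback
  obtain ⟨d', hd₁, hd₂⟩ := P.exists_transpose P₀.hom P₀.proj P₀.ev P₀.isPullback
  have hed : e ≫ d = 𝟙 _ := by
    refine (P.existsUnique_transpose P.hom P.proj P.ev P.isPullback).unique
      ⟨by rw [Category.assoc, hd, he], e' ≫ d', ?_, ?_⟩ ⟨Category.id_comp _, 𝟙 _, ?_, ?_⟩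
    · rw [Category.assoc, hd₁, reassoc_of% he₁]
    · rw [Category.assoc, hd₂, he₂]
    · rw [Category.comp_id, Category.id_comp]
    · rw [Category.id_comp]
  have hde : d ≫ e = 𝟙 _ := by
    refine (P₀.existsUnique_transpose P₀.hom P₀.proj P₀.ev P₀.isPullback).unique
      ⟨by rw [Category.assoc, he, hd], d' ≫ e', ?_, ?_⟩ ⟨Category.id_comp _, 𝟙 _, ?_, ?_⟩
    · rw [Category.assoc, he₁, reassoc_of% hd₁]
    · rw [Category.assoc, he₂, hd₂]
    · rw [Category.comp_id, Category.id_comp]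
    · rw [Category.id_comp]
  let ε : P.obj.obj i ≅ P₀.obj.obj i :=
    { hom := e.app i
      inv := d.app i
      hom_inv_id := NatTrans.congr_app hed i
      inv_hom_id := NatTrans.congr_app hde i }
  have hεr : ε.hom ≫ P₀.hom.app i = P.hom.app i := NatTrans.congr_app he i
  have h₁ := pullbackSec_res P₀.isPullback P.isPullback e he e' he₁ he₂ i
  have h₂ : pullbackSec P₀.isPullback i = x i := pullbackSec_repEv hx i
  rw [h₂] at h₁
  exact (hx i).of_iso ε hεr h₁

end RepDiagram

end PointwisePushforward

/-! ### Pushforwards of Reedy fibrations exist and are Reedy fibrations. -/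

section ReedyPushforward

variable {I : Type u₁} [Category.{v₁} I] {C : Type u₂} [Category.{v₂} C]

theorem IsRep.fib {Fib : MorphismProperty C} [Fib.IsMultiplicative] [Fib.RespectsIso] {Z R R' : C}
    {F : Psh.{v₂, u₂, w} Z} {r : R ⟶ Z} {x : F.obj r} {r' : R' ⟶ Z}
    {x' : F.obj r'} (hR : IsRep F r x) (hR' : IsRep F r' x') (h : Fib r) : Fib r' := by
  obtain ⟨e, he, -⟩ := hR'.exists_iso hR
  rw [← he]
  exact Fib.comp_mem _ _ (Fib.of_isIso _) h

section EvalApp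

variable {B A X : I ⥤ C} {k : X ⟶ B} {p : B ⟶ A} (P : Pushforward k p)

theorem Pushforward.isPullback_app [HasPullbacks C] (j : I) :
    IsPullback (P.proj.app j) ((P.ev ≫ k).app j) (P.hom.app j) (p.app j) :=
  P.isPullback.app j

/-- The value of the evaluation map of a pushforward of diagrams on a generalized element. -/
noncomputable def Pushforward.evalApp [HasPullbacks C] {j : I} {V : C} (x : V ⟶ P.obj.obj j)
    (y : V ⟶ B.obj j) (h : x ≫ P.hom.app j = y ≫ p.app j) : V ⟶ X.obj j :=
  (P.isPullback_app j).lift x y h ≫ P.ev.app j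

variable [HasPullbacks C]

/-- The components of a pushforward of diagrams need not be pushforwards of the components.
Evaluation at `j` therefore rests only on the fact that the defining pullback square is computed
objectwise. -/
theorem Pushforward.eq_evalApp {j : I} {V : C} (x : V ⟶ P.obj.obj j)
    (y : V ⟶ B.obj j) (h : x ≫ P.hom.app j = y ≫ p.app j) (l : V ⟶ P.pb.obj j)
    (h₁ : l ≫ P.proj.app j = x) (h₂ : l ≫ (P.ev ≫ k).app j = y) :
    l ≫ P.ev.app j = P.evalApp x y h := by
  rw [evalApp]
  congr 1
  apply (P.isPullback_app j).hom_ext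
  · rw [(P.isPullback_app j).lift_fst, h₁]
  · rw [(P.isPullback_app j).lift_snd, h₂]

theorem Pushforward.evalApp_app {j : I} {V : C} (x : V ⟶ P.obj.obj j)
    (y : V ⟶ B.obj j) (h : x ≫ P.hom.app j = y ≫ p.app j) : P.evalApp x y h ≫ k.app j = y := by
  rw [evalApp, Category.assoc]
  exact (P.isPullback_app j).lift_snd _ _ _

theorem Pushforward.comp_evalApp {j : I} {V V' : C} (z : V' ⟶ V) (x : V ⟶ P.obj.obj j)
    (y : V ⟶ B.obj j) (h : x ≫ P.hom.app j = y ≫ p.app j) : z ≫ P.evalApp x y h =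
      P.evalApp (z ≫ x) (z ≫ y) (by rw [Category.assoc, h, Category.assoc]) := by
  refine (Category.assoc _ _ _).symm.trans (P.eq_evalApp _ _ _ _ ?_ ?_)
  · rw [Category.assoc, (P.isPullback_app j).lift_fst]
  · rw [Category.assoc, (P.isPullback_app j).lift_snd]

theorem Pushforward.evalApp_congr {j : I} {V : C} {x x' : V ⟶ P.obj.obj j}
    {y y' : V ⟶ B.obj j} (hx : x = x') (hy : y = y') (h : x ≫ P.hom.app j = y ≫ p.app j) :
    P.evalApp x y h = P.evalApp x' y' (by rw [← hx, ← hy, h]) := by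
  subst hx hy
  rfl

theorem Pushforward.evalApp_map {j j' : I} (g : j ⟶ j') {V : C} (x : V ⟶ P.obj.obj j)
    (y : V ⟶ B.obj j) (h : x ≫ P.hom.app j = y ≫ p.app j) : P.evalApp x y h ≫ X.map g =
      P.evalApp (x ≫ P.obj.map g) (y ≫ B.map g) (by
        rw [Category.assoc, P.hom.naturality, reassoc_of% h, Category.assoc, p.naturality]) := by
  rw [evalApp, Category.assoc, ← P.ev.naturality, ← Category.assoc]
  refine P.eq_evalApp _ _ _ _ ?_ ?_
  · rw [Category.assoc, P.proj.naturality, ← Category.assoc, (P.isPullback_app j).lift_fst]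
  · rw [Category.assoc, (P.ev ≫ k).naturality, ← Category.assoc, (P.isPullback_app j).lift_snd]

end EvalApp

variable [HasFiniteLimits C] {B A X : I ⥤ C} {k : X ⟶ B} {p : B ⟶ A}

theorem Pushforward.ev_pullbackSec (P : Pushforward k p) {i j : I} (u : i ⟶ j) {V : C}
    (x : V ⟶ P.obj.obj i) (y : V ⟶ B.obj j) (h : x ≫ P.hom.app i ≫ A.map u = y ≫ p.app j) :
    (pullbackSec P.isPullback i).ev u x y h = P.evalApp (x ≫ P.obj.map u) y
      (by rw [Category.assoc, P.hom.naturality, h]) :=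
  InverseDiagrams.ev_pullbackSec P.isPullback i u x y h _
    ((P.isPullback_app j).lift_fst _ _ _) ((P.isPullback_app j).lift_snd _ _ _)

namespace Sec

variable {i : I} {S : Set (Under i)} {T : C} {t : T ⟶ A.obj i}
  (s : Sec (Shape.ofHom p i) k S t)

/-- The value at `u : i ⟶ j` of a natural family. -/
noncomputable def evOn {j : I} (u : i ⟶ j) (hu : Under.mk u ∈ S) {V : C} (x : V ⟶ T)
    (y : V ⟶ B.obj j) (h : x ≫ t ≫ A.map u = y ≫ p.app j) : V ⟶ X.obj j :=
  HomSec.eval (s.val (Under.mk u) hu) x y h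

theorem evOn_app {j : I} (u : i ⟶ j) (hu : Under.mk u ∈ S) {V : C} (x : V ⟶ T) (y : V ⟶ B.obj j)
    (h : x ≫ t ≫ A.map u = y ≫ p.app j) : s.evOn u hu x y h ≫ k.app j = y :=
  (HomSec.eval_over _ _ _ _).trans (Category.comp_id _)

theorem comp_evOn {j : I} (u : i ⟶ j) (hu : Under.mk u ∈ S) {V V' : C} (z : V' ⟶ V) (x : V ⟶ T)
    (y : V ⟶ B.obj j) (h : x ≫ t ≫ A.map u = y ≫ p.app j) : z ≫ s.evOn u hu x y h =
      s.evOn u hu (z ≫ x) (z ≫ y) (by rw [Category.assoc, h, Category.assoc]) :=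
  HomSec.comp_eval _ _ _ _ _

theorem evOn_map {j j' : I} (u : i ⟶ j) (hu : Under.mk u ∈ S) (g : j ⟶ j')
    (hu' : Under.mk (u ≫ g) ∈ S) {V : C} (x : V ⟶ T) (y : V ⟶ B.obj j)
    (h : x ≫ t ≫ A.map u = y ≫ p.app j) : s.evOn u hu x y h ≫ X.map g =
      s.evOn (u ≫ g) hu' x (y ≫ B.map g) (by
        rw [A.map_comp, Category.assoc, p.naturality, ← reassoc_of% h]) :=
  s.natural (f := Under.mk u) (f' := Under.mk (u ≫ g)) hu hu' (Under.homMk g) x y h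

theorem evOn_congr {j : I} {u u' : i ⟶ j} (e : u = u') (hu : Under.mk u ∈ S) {V : C}
    {x x' : V ⟶ T} (hx : x = x') {y y' : V ⟶ B.obj j} (hy : y = y')
    (h : x ≫ t ≫ A.map u = y ≫ p.app j) : s.evOn u hu x y h =
      s.evOn u' (e ▸ hu) x' y' (by rw [← e, ← hx, ← hy, h]) := by
  subst e hx hy
  rfl

theorem ext_evOn {s s' : Sec (Shape.ofHom p i) k S t}
    (H : ∀ {j : I} (u : i ⟶ j) (hu : Under.mk u ∈ S) {V : C} (x : V ⟶ T) (y : V ⟶ B.obj j)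
      (h : x ≫ t ≫ A.map u = y ≫ p.app j), s.evOn u hu x y h = s'.evOn u hu x y h) : s = s' := by
  ext f hf : 3
  exact HomSec.ext_eval fun x y h => H f.hom hf x y h

theorem evOn_res {T' : C} {t' : T' ⟶ A.obj i} (v : T' ⟶ T) (hv : v ≫ t = t') {j : I} (u : i ⟶ j)
    (hu : Under.mk u ∈ S) {V : C} (x : V ⟶ T') (y : V ⟶ B.obj j)
    (h : x ≫ t' ≫ A.map u = y ≫ p.app j) :
    Sec.evOn ((secPsh (Shape.ofHom p i) k S).res v hv s) u hu x y h =
      s.evOn u hu (x ≫ v) y (by rw [Category.assoc, reassoc_of% hv, h]) :=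
  HomSec.eval_res v hv _ _ _ _

/-- Restriction of a natural family along a map `g : i ⟶ j` in the cosieve. -/
noncomputable def shiftOn (hS : IsCosieve S) {j : I} (g : i ⟶ j) (hg : Under.mk g ∈ S) :
    Sec (Shape.ofHom p j) k Set.univ (t ≫ A.map g) :=
  ofEv
    { ev := fun u _ x y h => s.evOn (g ≫ u) (hS (Under.homMk u) hg) x y
        (by rw [A.map_comp, ← h, Category.assoc])
      ev_app := fun _ _ _ _ _ => s.evOn_app _ _ _ _ _
      comp_ev := fun _ _ _ _ _ _ _ => s.comp_evOn _ _ _ _ _ _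
      ev_map := fun u g' _ _ _ _ => (s.evOn_map _ _ g'
          (hS (Under.homMk g' : Under.mk (g ≫ u) ⟶ Under.mk ((g ≫ u) ≫ g'))
            (hS (Under.homMk u : Under.mk g ⟶ Under.mk (g ≫ u)) hg)) _ _ _).trans
        (s.evOn_congr (Category.assoc _ _ _) _ rfl rfl _) }

theorem ev_shiftOn (hS : IsCosieve S) {j : I} (g : i ⟶ j) (hg : Under.mk g ∈ S) {l : I} (u : j ⟶ l)
    {V : C} (x : V ⟶ T) (y : V ⟶ B.obj l) (h : x ≫ (t ≫ A.map g) ≫ A.map u = y ≫ p.app l) :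
    (s.shiftOn hS g hg).ev u x y h = s.evOn (g ≫ u) (hS (Under.homMk u) hg) x y
      (by rw [A.map_comp, ← h, Category.assoc]) :=
  ev_ofEv _ _ _ _ _

end Sec

variable [∀ i : I, Finite (Under i)]

/-- The natural family on the non-identity maps given by the matching object of a pushforward. -/
noncomputable def Pushforward.relMatchingSec (P : Pushforward k p) (i : I) :
    Sec (Shape.ofHom p i) k {f | f ≠ Under.mk (𝟙 i)} (relMatchingFst P.hom i) where
  val f hf :=
    { hom := P.evalApp (pullback.fst _ _ ≫ relMatchingπ P.hom i ⟨f, hf⟩) (pullback.snd _ _) (by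
        rw [Category.assoc, relMatchingπ_app]
        exact pullback.condition)
      hom_comp := (P.evalApp_app _ _ _).trans (Category.comp_id _).symm }
  natural {f f'} hf hf' g V x y h := by
    simp only [HomSec.eval, P.comp_evalApp, P.evalApp_map]
    refine P.evalApp_congr ?_ ?_ _
    · rw [Category.assoc, Category.assoc]
      rw [show relMatchingπ P.hom i ⟨f, hf⟩ ≫ P.obj.map g.right = relMatchingπ P.hom i ⟨f', hf'⟩
        from relMatchingπ_map i (h := ⟨f, hf⟩) (h' := ⟨f', hf'⟩) ⟨g⟩]
      rw [← Category.assoc, ← Category.assoc, pullback.lift_fst, pullback.lift_fst]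
    · rw [pullback.lift_snd, pullback.lift_snd]

theorem Pushforward.evOn_relMatchingSec (P : Pushforward k p) {i j : I} (u : i ⟶ j)
    (hu : Under.mk u ≠ Under.mk (𝟙 i)) {V : C} (x : V ⟶ relMatchingObj P.hom i) (y : V ⟶ B.obj j)
    (h : x ≫ relMatchingFst P.hom i ≫ A.map u = y ≫ p.app j) :
    (P.relMatchingSec i).evOn u hu x y h = P.evalApp (x ≫ relMatchingπ P.hom i ⟨Under.mk u, hu⟩) y
      (by rw [Category.assoc, relMatchingπ_app]; exact h) := by
  refine (P.comp_evalApp _ _ _ _).trans (P.evalApp_congr ?_ ?_ _)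
  · rw [← Category.assoc]
    exact congrArg (· ≫ relMatchingπ P.hom i ⟨Under.mk u, hu⟩) (pullback.lift_fst _ _ _)
  · exact pullback.lift_snd _ _ _

/-- The projection of the relative matching map at `u` is `P.obj.map u`, which is where the
universal family at `u` evaluates `P`. -/
theorem Pushforward.isRepMap_relMatchingMap (P : Pushforward k p) (i : I) :
    IsRepMap (secRestrict (Shape.ofHom p i) k
      (Set.subset_univ {f : Under i | f ≠ Under.mk (𝟙 i)})) (pullbackSec P.isPullback i)
      (P.relMatchingSec i) (relMatchingMap P.hom i) := by
  refine ⟨relMatchingMap_fst i, Sec.ext_evOn fun {j} u hu V x y h => ?_⟩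
  rw [Sec.evOn_res (P.relMatchingSec i) _ (relMatchingMap_fst i) u hu x y h, P.evOn_relMatchingSec]
  refine Eq.trans (P.evalApp_congr ?_ rfl _) (P.ev_pullbackSec u x y h).symm
  rw [Category.assoc, relMatchingMap_π]
  rfl

/-- A family on the non-identity maps out of $i$ restricts along each such $f\colon i\to j$ to a
full family on $j/\mathcal I$, that is, to a map $T\to(p_*X)_j$. These maps are compatible, so with
`t` they form a map into $A_i\times_{M_iA}M_i(p_*X)$. -/
theorem Pushforward.isRep_relMatchingSec [IsInverse I] (P : Pushforward k p)
    (hP : ∀ i, IsRep (secPsh (Shape.ofHom p i) k Set.univ) (P.hom.app i)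
      (pullbackSec P.isPullback i)) (i : I) :
    IsRep (secPsh (Shape.ofHom p i) k {f | f ≠ Under.mk (𝟙 i)}) (relMatchingFst P.hom i)
      (P.relMatchingSec i) where
  surj {T} t s := by
    have hS := isCosieve_boundary i
    have H := fun f : Boundary i => (hP f.obj.right).surj (t ≫ A.map f.obj.hom)
      (Sec.shiftOn s hS f.obj.hom f.property)
    choose v hv hvs using H
    have hev : ∀ (f : Boundary i) {j : I} (u : f.obj.right ⟶ j) {V : C} (x : V ⟶ T)
        (y : V ⟶ B.obj j) (h : x ≫ (t ≫ A.map f.obj.hom) ≫ A.map u = y ≫ p.app j),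
        (pullbackSec P.isPullback f.obj.right).ev u (x ≫ v f) y
          (by rw [Category.assoc, reassoc_of% (hv f), ← h, Category.assoc]) =
        Sec.evOn s (f.obj.hom ≫ u) (hS (Under.homMk u) f.property) x y
          (by rw [A.map_comp, ← h, Category.assoc]) := by
      intro f j u V x y h
      rw [← Sec.ev_shiftOn s hS f.obj.hom f.property u x y h, ← hvs f]
      exact (Sec.ev_res _ (v f) (hv f) u x y h).symm
    have hcomp : ∀ (f f' : Boundary i) (φ : f ⟶ f'), v f ≫ P.obj.map φ.hom.right = v f' := by
      intro f f' φ
      refine (hP f'.obj.right).hom_ext_ev (t := t ≫ A.map f'.obj.hom) ?_ (hv f')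
        fun {j} u V x y h => ?_
      · rw [Category.assoc, P.hom.naturality, reassoc_of% (hv f), ← A.map_comp, Under.w]
      · rw [hev f' u x y h, P.ev_pullbackSec]
        have h' : x ≫ (t ≫ A.map f.obj.hom) ≫ A.map (φ.hom.right ≫ u) = y ≫ p.app j := by
          rw [A.map_comp, Category.assoc, ← A.map_comp_assoc, Under.w, ← Category.assoc t, h]
        refine Eq.trans ?_ ((hev f (φ.hom.right ≫ u) x y h').trans ?_)
        · rw [P.ev_pullbackSec]
          exact P.evalApp_congr (by simp) rfl _
        · refine Sec.evOn_congr s ?_ _ rfl rfl _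
          rw [← Category.assoc, Under.w]
    refine ⟨relMatchingLift t v hcomp hv, relMatchingLift_fst _ _ _ _,
      Sec.ext_evOn fun {j} u hu V x y h => ?_⟩
    rw [Sec.evOn_res (P.relMatchingSec i) _ (relMatchingLift_fst t v hcomp hv) u hu x y h,
      P.evOn_relMatchingSec]
    -- The value of the given family at `u` is recovered as the value at `𝟙 j` of its restriction
    -- along `u`.
    have h' : x ≫ (t ≫ A.map u) ≫ A.map (𝟙 j) = y ≫ p.app j := by
      rw [A.map_id, Category.comp_id, h]
    refine Eq.trans ?_ ((hev ⟨Under.mk u, hu⟩ (𝟙 j) x y h').trans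
      (Sec.evOn_congr s (Category.comp_id _) _ rfl rfl _))
    rw [P.ev_pullbackSec]
    refine P.evalApp_congr ?_ rfl _
    rw [Category.assoc, relMatchingLift_π]
    exact ((congrArg ((x ≫ v ⟨Under.mk u, hu⟩) ≫ ·) (P.obj.map_id j)).trans
      (Category.comp_id _)).symm
  inj {T t v v'} hv hv' H := by
    refine relMatchingObj_hom_ext (by rw [hv, hv']) fun f => ?_
    refine (hP f.obj.right).hom_ext_ev (t := t ≫ A.map f.obj.hom)
      (by rw [Category.assoc, relMatchingπ_app, reassoc_of% hv])
      (by rw [Category.assoc, relMatchingπ_app, reassoc_of% hv']) fun {j} u V x y h => ?_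
    have hu := isCosieve_boundary i (Under.homMk u : f.obj ⟶ Under.mk (f.obj.hom ≫ u)) f.property
    have hπ : relMatchingπ P.hom i f ≫ P.obj.map u =
        relMatchingπ P.hom i ⟨Under.mk (f.obj.hom ≫ u), hu⟩ :=
      relMatchingπ_map i (h := f) (h' := ⟨Under.mk (f.obj.hom ≫ u), hu⟩) ⟨Under.homMk u⟩
    have h' : x ≫ t ≫ A.map (f.obj.hom ≫ u) = y ≫ p.app j := by
      rw [A.map_comp, ← h, Category.assoc]
    have key := congrArg (fun s : Sec (Shape.ofHom p i) k {f | f ≠ Under.mk (𝟙 i)} t =>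
      s.evOn (f.obj.hom ≫ u) hu x y h') H
    dsimp only at key
    rw [Sec.evOn_res (P.relMatchingSec i) v hv, Sec.evOn_res (P.relMatchingSec i) v' hv',
      P.evOn_relMatchingSec, P.evOn_relMatchingSec] at key
    rw [P.ev_pullbackSec, P.ev_pullbackSec]
    refine (P.evalApp_congr ?_ rfl _).trans (key.trans (P.evalApp_congr ?_ rfl _))
    · rw [Category.assoc, Category.assoc, Category.assoc, hπ]
    · rw [Category.assoc, Category.assoc, Category.assoc, hπ]

variable {Fib : MorphismProperty C} [Fib.IsMultiplicative] [Fib.IsStableUnderBaseChange]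
  [IsInverse I]

theorem exists_isRep_univ (hFib : FibrationsStableUnderPushforward Fib)
    (hk : IsReedyFibration Fib k) (hp : ∀ j, Fib (p.app j)) :
    ∃ (R : I → C) (r : ∀ i, R i ⟶ A.obj i) (x : ∀ i, Sec (Shape.ofHom p i) k Set.univ (r i)),
      (∀ i, IsRep (secPsh (Shape.ofHom p i) k Set.univ) (r i) (x i)) ∧ ∀ i, Fib (r i) := by
  have H := fun i => exists_isRep_sec (Shape.ofHom p i) k hFib hk (fun f => hp f.right)
    (isCosieve_univ i)
  choose R r x hx hr using H
  exact ⟨R, r, x, hx, hr⟩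

/-- Pushforwards of Reedy fibrations along pointwise fibrations exist. -/
theorem nonempty_pushforward_of_reedy (hFib : FibrationsStableUnderPushforward Fib)
    (hk : IsReedyFibration Fib k) (hp : ∀ j, Fib (p.app j)) : Nonempty (Pushforward k p) := by
  obtain ⟨R, r, x, hx, -⟩ := exists_isRep_univ hFib hk hp
  exact ⟨repPushforward hx⟩

theorem Pushforward.isRep_pullbackSec_of_reedy (hFib : FibrationsStableUnderPushforward Fib)
    (hk : IsReedyFibration Fib k) (hp : ∀ j, Fib (p.app j)) (P : Pushforward k p) (i : I) :
    IsRep (secPsh (Shape.ofHom p i) k Set.univ) (P.hom.app i) (pullbackSec P.isPullback i) := by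
  obtain ⟨R, r, x, hx, -⟩ := exists_isRep_univ hFib hk hp
  exact isRep_pullbackSec hx P i

theorem Pushforward.fib_hom_app (hFib : FibrationsStableUnderPushforward Fib)
    (hk : IsReedyFibration Fib k) (hp : ∀ j, Fib (p.app j)) (P : Pushforward k p) (i : I) :
    Fib (P.hom.app i) := by
  obtain ⟨R, r, x, hx, hr⟩ := exists_isRep_sec (Shape.ofHom p i) k hFib hk (fun f => hp f.right)
    (isCosieve_univ i)
  exact hx.fib (P.isRep_pullbackSec_of_reedy hFib hk hp i) hr

theorem Pushforward.fib_relMatchingFst (hFib : FibrationsStableUnderPushforward Fib)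
    (hk : IsReedyFibration Fib k) (hp : ∀ j, Fib (p.app j)) (P : Pushforward k p) (i : I) :
    Fib (relMatchingFst P.hom i) := by
  obtain ⟨R, r, x, hx, hr⟩ := exists_isRep_sec (Shape.ofHom p i) k hFib hk (fun f => hp f.right)
    (isCosieve_boundary i)
  exact hx.fib (P.isRep_relMatchingSec (P.isRep_pullbackSec_of_reedy hFib hk hp) i) hr

/-- Pushforwards of Reedy fibrations along pointwise fibrations are Reedy fibrations. -/
theorem Pushforward.isReedyFibration_hom (hFib : FibrationsStableUnderPushforward Fib)
    (hk : IsReedyFibration Fib k) (hp : ∀ j, Fib (p.app j)) (P : Pushforward k p) :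
    IsReedyFibration Fib P.hom := by
  intro i
  have hP := P.isRep_pullbackSec_of_reedy hFib hk hp
  -- The cosieve of all maps is the boundary together with the identity. Generalizing over `S` lets
  -- this equality be substituted, since the universal element depends on the set.
  have key : ∀ {S : Set (Under i)} (hS : {f : Under i | f ≠ Under.mk (𝟙 i)} ⊆ S)
      (_ : S = insert (Under.mk (𝟙 i)) {f | f ≠ Under.mk (𝟙 i)})
      {y : (secPsh (Shape.ofHom p i) k S).obj (P.hom.app i)}
      (_ : IsRep (secPsh (Shape.ofHom p i) k S) (P.hom.app i) y)
      (_ : IsRepMap (secRestrict (Shape.ofHom p i) k hS) y (P.relMatchingSec i)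
        (relMatchingMap P.hom i)), Fib (relMatchingMap P.hom i) := by
    rintro S hS rfl y hy hm
    refine fib_of_isRepMap_secRestrict (Shape.ofHom p i) k hFib hk (Under.mk (𝟙 i))
      (Set.notMem_ofPred_iff.mpr (not_not.mpr rfl)) (isCosieve_boundary i) (fun h => ?_) (hp i)
      (P.isRep_relMatchingSec hP i) hy hm
    change Under.mk (𝟙 i ≫ h.obj.hom) ≠ _
    rw [Category.id_comp]
    exact h.property
  refine key (Set.subset_univ _) ?_ (hP i) (P.isRepMap_relMatchingMap i)
  ext f
  simpa using em (f = Under.mk (𝟙 i))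

/-- A map of diagrams is its own pushforward along the identity. -/
noncomputable def Pushforward.ofId {D : Type*} [Category* D] {X B : D} (k : X ⟶ B) :
    Pushforward k (𝟙 B) where
  obj := X
  hom := k
  pb := X
  proj := 𝟙 X
  ev := 𝟙 X
  isPullback := by
    rw [Category.id_comp]
    exact IsPullback.of_horiz_isIso ⟨by simp⟩
  existsUnique_transpose {T Y} t y u h := by
    have : IsIso y := h.isIso_fst_of_isIso
    refine ⟨inv y ≫ u, ⟨?_, u, by simp, by simp⟩, ?_⟩
    · rw [Category.assoc, IsIso.inv_comp_eq, h.w, Category.comp_id]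
    · rintro v ⟨-, w, h₁, h₂⟩
      rw [IsIso.eq_inv_comp, ← h₁, ← h₂]

/-- `k` is its own pushforward along the identity of its target, so objectwise fibrancy is the case
`p = 𝟙` of the result on pushforwards. -/
theorem IsReedyFibration.fib_app (hFib : FibrationsStableUnderPushforward Fib)
    (hk : IsReedyFibration Fib k) (i : I) : Fib (k.app i) :=
  (Pushforward.ofId k).fib_hom_app hFib hk (fun _ => Fib.id_mem _) i

theorem IsReedyFibration.fib_relMatchingFst (hFib : FibrationsStableUnderPushforward Fib)
    (hk : IsReedyFibration Fib k) (i : I) : Fib (relMatchingFst k i) :=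
  (Pushforward.ofId k).fib_relMatchingFst hFib hk (fun _ => Fib.id_mem _) i

end ReedyPushforward

/-! ### Weak equivalences between representing objects, and the cogluing lemma. -/

section Cogluing

variable {C : Type u₂} [Category.{v₂} C]

theorem weq_of_isIso {W : MorphismProperty C} (hW : MorphismProperty.isomorphisms C ≤ W) {X Y : C}
    (f : X ⟶ Y) [IsIso f] :
    W f :=
  hW f (MorphismProperty.isomorphisms.infer_property f)

variable {W : MorphismProperty C}

/-- Whether the map corresponding to a map of presheaves is a weak equivalence does not depend on
the representing objects. -/
theorem IsRepMap.weq [W.IsMultiplicative] (hW : MorphismProperty.isomorphisms C ≤ W) {Z : C}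
    {F : Psh.{v₂, u₂, w₁} Z}
    {G : Psh.{v₂, u₂, w₂} Z} {φ : PshMap F G} {E R E' R' : C} {e : E ⟶ Z} {x : F.obj e} {r : R ⟶ Z}
    {y : G.obj r} {e' : E' ⟶ Z} {x' : F.obj e'} {r' : R' ⟶ Z} {y' : G.obj r'} {d : E ⟶ R}
    {d' : E' ⟶ R'} (hd : IsRepMap φ x y d) (hd' : IsRepMap φ x' y' d') (hx : IsRep F e x)
    (hy : IsRep G r y) (hx' : IsRep F e' x') (hy' : IsRep G r' y') (h : W d) : W d' := by
  obtain ⟨ε, hε, hεx⟩ := hx'.exists_iso hx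
  obtain ⟨ρ, hρ, hρy⟩ := hy.exists_iso hy'
  have : d' = (ε.hom ≫ d) ≫ ρ.hom := by
    refine hy'.inj (t := e') hd'.1 (by rw [Category.assoc, hρ, Category.assoc, hd.1, hε]) ?_
    rw [← G.res_res ρ.hom hρ (ε.hom ≫ d) (by rw [Category.assoc, hd.1, hε]), hρy,
      hd.res ε.hom hε, hεx, hd'.2]
  rw [this]
  exact W.comp_mem _ _ (W.comp_mem _ _ (weq_of_isIso hW _) h) (weq_of_isIso hW _)

variable [HasPullbacks C] {Fib : MorphismProperty C} [W.HasTwoOutOfThreeProperty]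

/-- The cogluing lemma: weak equivalences between cospans, one leg of each of which is a
fibration, induce weak equivalences on pullbacks. -/
theorem PullbacksLogicallyBehaved.weq_of_cospan [Fib.IsStableUnderBaseChange]
    (hpb : PullbacksLogicallyBehaved Fib W) {P X Y Z P' X' Y' Z' : C} {p₁ : P ⟶ X} {p₂ : P ⟶ Y}
    {x : X ⟶ Z} {y : Y ⟶ Z} {p₁' : P' ⟶ X'} {p₂' : P' ⟶ Y'} {x' : X' ⟶ Z'} {y' : Y' ⟶ Z'}
    (h : IsPullback p₁ p₂ x y) (h' : IsPullback p₁' p₂' x' y') (hx : Fib x) (hx' : Fib x')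
    {α : X ⟶ X'} {β : Y ⟶ Y'} {γ : Z ⟶ Z'} {δ : P ⟶ P'} (hα : W α) (hβ : W β) (hγ : W γ)
    (hαγ : α ≫ x' = x ≫ γ) (hβγ : β ≫ y' = y ≫ γ) (h₁ : δ ≫ p₁' = p₁ ≫ α)
    (h₂ : δ ≫ p₂' = p₂ ≫ β) : W δ := by
  have hQ := IsPullback.of_hasPullback x' γ
  have hq₂ : Fib (pullback.snd x' γ) := Fib.of_isPullback hQ hx'
  have hq₁ : W (pullback.fst x' γ) := hpb.weq_of_isPullback hQ hx' hγ
  let a : X ⟶ pullback x' γ := pullback.lift α x hαγ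
  have ha₁ : a ≫ pullback.fst x' γ = α := pullback.lift_fst _ _ _
  have ha₂ : a ≫ pullback.snd x' γ = x := pullback.lift_snd _ _ _
  have ha : W a := W.of_postcomp _ _ hq₁ (by rwa [ha₁])
  have hP₂ := IsPullback.of_hasPullback (pullback.snd x' γ) y
  have hl := hpb.weq_pullback h hP₂ a ha₂ hx hq₂ ha
  have hR : IsPullback (pullback.fst (pullback.snd x' γ) y ≫ pullback.fst x' γ)
      (pullback.snd (pullback.snd x' γ) y) x' (β ≫ y') := by
    rw [hβγ]
    exact hP₂.paste_horiz hQ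
  let m : pullback (pullback.snd x' γ) y ⟶ P' :=
    h'.lift (pullback.fst (pullback.snd x' γ) y ≫ pullback.fst x' γ)
      (pullback.snd (pullback.snd x' γ) y ≫ β) (by rw [hR.w, Category.assoc])
  have hm₁ : m ≫ p₁' = pullback.fst (pullback.snd x' γ) y ≫ pullback.fst x' γ := h'.lift_fst _ _ _
  have hm₂ : m ≫ p₂' = pullback.snd (pullback.snd x' γ) y ≫ β := h'.lift_snd _ _ _
  have hmp : IsPullback m (pullback.snd (pullback.snd x' γ) y) p₂' β :=
    IsPullback.of_right (by rw [hm₁]; exact hR) hm₂ h'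
  have hm : W m := hpb.weq_of_isPullback hmp (Fib.of_isPullback h' hx') hβ
  have hδ : δ = hP₂.lift (p₁ ≫ a) p₂ (by rw [Category.assoc, ha₂, h.w]) ≫ m := by
    apply h'.hom_ext
    · rw [Category.assoc, hm₁, h₁, ← Category.assoc, hP₂.lift_fst, Category.assoc, ha₁]
    · rw [Category.assoc, hm₂, h₂, ← Category.assoc, hP₂.lift_snd]
  rw [hδ]
  exact W.comp_mem _ _ hl hm

end Cogluing

/-! ### Precomposition on presheaves of maps, and assumption (4). -/

section Precomposition

variable {C : Type u₂} [Category.{v₂} C]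

section

variable {Z A Y B X A' Y' : C} {a : Z ⟶ A} {q : Y ⟶ A} {b : Y ⟶ B} {k : X ⟶ B} {a' : Z ⟶ A'}
  {q' : Y' ⟶ A'} {b' : Y' ⟶ B} {c : A' ⟶ A} {d : Y' ⟶ Y}

theorem precomp_condition (hq : q' ≫ c = d ≫ q) (ha : a' ≫ c = a) {T : C} {t : T ⟶ Z} {V : C}
    {x : V ⟶ T} {y : V ⟶ Y'} (h : x ≫ t ≫ a' = y ≫ q') : x ≫ t ≫ a = (y ≫ d) ≫ q := by
  rw [← ha, Category.assoc, ← hq, ← reassoc_of% h]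

variable [HasPullbacks C]

/-- Precomposition with a map of shapes. -/
noncomputable def HomSec.precomp (hq : q' ≫ c = d ≫ q) (ha : a' ≫ c = a) (hb : d ≫ b = b')
    {T : C} {t : T ⟶ Z} (u : HomSec a q b k t) : HomSec a' q' b' k t :=
  HomSec.ofEval (fun x y h => u.eval x (y ≫ d) (precomp_condition hq ha h))
    (fun x y h => by rw [u.eval_over, Category.assoc, hb])

theorem HomSec.eval_precomp (hq : q' ≫ c = d ≫ q) (ha : a' ≫ c = a) (hb : d ≫ b = b')
    {T : C} {t : T ⟶ Z} (u : HomSec a q b k t) {V : C} (x : V ⟶ T) (y : V ⟶ Y')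
    (h : x ≫ t ≫ a' = y ≫ q') : (u.precomp hq ha hb).eval x y h =
      u.eval x (y ≫ d) (precomp_condition hq ha h) := by
  refine HomSec.eval_ofEval _ (fun x y h => by rw [u.eval_over, Category.assoc, hb])
    (fun z x y h => ?_) x y h
  rw [HomSec.comp_eval]
  exact HomSec.eval_congr _ rfl (Category.assoc _ _ _).symm _

/-- Precomposition with a map of shapes, as a map of presheaves. -/
noncomputable def homPsh.precomp (k : X ⟶ B) (hq : q' ≫ c = d ≫ q) (ha : a' ≫ c = a)
    (hb : d ≫ b = b') : PshMap (homPsh a q b k) (homPsh a' q' b' k) where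
  app u := HomSec.precomp hq ha hb u
  app_res v hv u := HomSec.ext_eval fun x y h => by
    rw [homPsh.eval_res, HomSec.eval_precomp, HomSec.eval_precomp]
    exact homPsh.eval_res v hv _ _ _ _

end

variable [HasPullbacks C] {Fib W : MorphismProperty C} [W.IsMultiplicative]
  [Fib.IsStableUnderBaseChange]

theorem Pushforward.evalAt_precomp {X B A B' A' : C} {k : X ⟶ B} {p : B ⟶ A}
    (P : Pushforward k p) {p' : B' ⟶ A'} {g : B' ⟶ B} {f : A' ⟶ A} (sq : g ≫ p = p' ≫ f)
    {F : C} {a : F ⟶ P.obj} {a' : F ⟶ A'} (hF : IsPullback a a' P.hom f)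
    {D : C} {d : D ⟶ X} {k' : D ⟶ B'} (hD : IsPullback d k' k g) (P' : Pushforward k' p') {V : C}
    (x : V ⟶ F) (y : V ⟶ B') (h : x ≫ a' = y ≫ p')
    (h' : (x ≫ P.precomp sq hF hD P') ≫ P'.hom = y ≫ p') :
    P'.evalAt (x ≫ P.precomp sq hF hD P') y h' ≫ d = P.evalAt (x ≫ a) (y ≫ g)
      (by rw [Category.assoc, hF.w, Category.assoc, sq, reassoc_of% h]) := by
  have hG := IsPullback.of_hasPullback a' p'
  have e : P.pullbackEv sq hF hD hG ≫ k' = pullback.snd a' p' := hD.lift_snd _ _ _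
  have e' : P.evalAt (pullback.fst a' p' ≫ a) (pullback.snd a' p' ≫ g)
      (by rw [Category.assoc, hF.w, reassoc_of% hG.w, Category.assoc, sq]) =
      P.pullbackEv sq hF hD hG ≫ d := (hD.lift_fst _ _ _).symm
  rw [P'.evalAt_transpose a' (pullback.fst a' p') (P.pullbackEv sq hF hD hG) (by rwa [e]) _ _ h'
    (pullback.lift x y h), Category.assoc, ← e', P.comp_evalAt]
  · refine P.evalAt_congr ?_ ?_ _
    · rw [← Category.assoc, pullback.lift_fst]
    · rw [← Category.assoc, pullback.lift_snd]
  · rw [← Category.assoc, pullback.lift_fst]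
    rfl
  · rw [e, pullback.lift_snd]

/-- This restates the map $(g^*\mathrm{ev})^\dagger$ of assumption (4) as a map of presheaves:
$f^*p_*X$ and $p'_*g^*X$ represent the maps to $X$ out of $T\times_AB$ and $T\times_{A'}B'$, and the
comparison is restriction along $B'\to B$. -/
theorem Pushforward.isRepMap_precomp {X B A B' A' : C} {k : X ⟶ B} {p : B ⟶ A}
    (P : Pushforward k p) {p' : B' ⟶ A'} {g : B' ⟶ B} {f : A' ⟶ A} (sq : g ≫ p = p' ≫ f)
    {F : C} {a : F ⟶ P.obj} {a' : F ⟶ A'} (hF : IsPullback a a' P.hom f)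
    {D : C} {d : D ⟶ X} {k' : D ⟶ B'} (hD : IsPullback d k' k g) (P' : Pushforward k' p') :
    IsRepMap (homPsh.precomp k sq.symm (Category.id_comp f) (Category.comp_id g))
      (P.homSec (IsPullback.id_horiz k).toCommSq hF.toCommSq)
      (P'.homSec hD.toCommSq (IsPullback.id_horiz P'.hom).toCommSq)
      (P.precomp sq hF hD P') := by
  have h₁ : P.precomp sq hF hD P' ≫ P'.hom = a' := P'.transpose_hom _ _ _ _
  refine ⟨h₁, HomSec.ext_eval fun {V} x y h => ?_⟩
  have h' : x ≫ a' = y ≫ p' := by rw [← h, Category.comp_id]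
  refine Eq.trans ?_ (HomSec.eval_precomp sq.symm (Category.id_comp f) (Category.comp_id g)
    _ x y h).symm
  rw [homPsh.eval_res, P'.eval_homSec, P.eval_homSec, P'.evalAt_congr (Category.comp_id _) rfl,
    P.evalAt_precomp sq hF hD P' x y h']
  exact (Category.comp_id _).symm

/-- Precomposition with weak equivalences corresponds to a weak equivalence. -/
theorem PushforwardsLogicallyBehaved.weq_of_isRepMap_precomp
    (hW : MorphismProperty.isomorphisms C ≤ W) (hFib : FibrationsStableUnderPushforward Fib)
    (hpf : PushforwardsLogicallyBehaved Fib W) {X B A B' A' : C} {k : X ⟶ B} {p : B ⟶ A}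
    {p' : B' ⟶ A'} {g : B' ⟶ B} {f : A' ⟶ A} (sq : p' ≫ f = g ≫ p) (hk : Fib k) (hp : Fib p)
    (hp' : Fib p') (hf : W f) (hg : W g) {E R : C} {e : E ⟶ A'} {r : R ⟶ A'}
    {x : (homPsh f p (𝟙 B) k).obj e} {y : (homPsh (𝟙 A') p' g k).obj r}
    (hx : IsRep (homPsh f p (𝟙 B) k) e x) (hy : IsRep (homPsh (𝟙 A') p' g k) r y) {m : E ⟶ R}
    (hm : IsRepMap (homPsh.precomp k sq (Category.id_comp f) (Category.comp_id g)) x y m) :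
    W m := by
  obtain ⟨P⟩ := hFib.nonempty_pushforward k p hk hp
  obtain ⟨P'⟩ := hFib.nonempty_pushforward (pullback.snd k g) p'
    (Fib.of_isPullback (IsPullback.of_hasPullback k g) hk) hp'
  have hF := IsPullback.of_hasPullback P.hom f
  have hD := IsPullback.of_hasPullback k g
  exact (P.isRepMap_precomp sq.symm hF hD P').weq hW hm (P.isRep_homSec (IsPullback.id_horiz k) hF)
    (P'.isRep_homSec hD (IsPullback.id_horiz P'.hom)) hx hy
      (hpf.weq_precomp P sq.symm hF hD P' hk hp hp' hf hg)

end Precomposition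

/-! ### Representability and fibrations for presheaves of maps. -/

section HomPshFibrations

variable {C : Type u₂} [Category.{v₂} C] [HasPullbacks C] {Fib : MorphismProperty C}
  [Fib.IsStableUnderBaseChange]

theorem exists_isRep_homPsh (hFib : FibrationsStableUnderPushforward Fib) {Z A Y B X : C}
    (a : Z ⟶ A) (q : Y ⟶ A) (b : Y ⟶ B) (k : X ⟶ B) (hq : Fib q) (hk : Fib k) :
    ∃ (R : C) (r : R ⟶ Z) (x : (homPsh a q b k).obj r), IsRep (homPsh a q b k) r x := by
  obtain ⟨P⟩ := hFib.nonempty_pushforward (pullback.snd k b) q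
    (Fib.of_isPullback (IsPullback.of_hasPullback k b) hk) hq
  exact ⟨_, _, _, P.isRep_homSec (IsPullback.of_hasPullback k b)
    (IsPullback.of_hasPullback P.hom a)⟩

/-- Postcomposition with a fibration corresponds to a fibration. -/
theorem fib_of_isRepMap_postcomp [Fib.IsMultiplicative]
    (hFib : FibrationsStableUnderPushforward Fib) {Z A Y B X N : C} {a : Z ⟶ A} {q : Y ⟶ A}
    {b : Y ⟶ B} {k : X ⟶ B} {n : N ⟶ B} (m : X ⟶ N) (hm : m ≫ n = k) (hmF : Fib m) (hq : Fib q)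
    {E R : C} {e : E ⟶ Z} {r : R ⟶ Z} {x : (homPsh a q b k).obj e} {y : (homPsh a q b n).obj r}
    (hx : IsRep (homPsh a q b k) e x) (hy : IsRep (homPsh a q b n) r y) {d : E ⟶ R}
    (hd : IsRepMap (homPsh.postcomp a q b m hm) x y d) : Fib d := by
  -- The degenerate pullback square with identities as horizontal maps reduces the claim to
  -- `PshPullback.exists_isRep`.
  have H : PshPullback (homPsh.postcomp a q b m hm)
      (⟨fun s => s, fun _ _ _ => rfl⟩ : PshMap (homPsh a q b k) (homPsh a q b k))
      (⟨fun s => s, fun _ _ _ => rfl⟩ : PshMap (homPsh a q b n) (homPsh a q b n))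
      (homPsh.postcomp a q b m hm) :=
    { comm := fun _ => rfl
      lift := fun _ l h => ⟨l, h.symm, rfl⟩
      ext := fun _ h => h }
  obtain ⟨E', e', y', hE', he', hfib⟩ := H.exists_isRep hFib hy hmF hq
  obtain ⟨ε, hε, hεy⟩ := hx.exists_iso hE'
  have : ε.hom ≫ e' = d := by
    refine hy.inj (t := e) (by rw [Category.assoc, he'.1, hε]) hd.1 ?_
    rw [he'.res ε.hom hε, hεy, hd.2]
  rw [← this]
  exact Fib.comp_mem _ _ (Fib.of_isIso _) hfib

end HomPshFibrations

/-! ### Precomposition of natural families with a map of shapes. -/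

section ShapeHom

variable {I : Type u₁} [Category.{v₁} I] {C : Type u₂} [Category.{v₂} C]

/-- A map between shapes. -/
structure Shape.Hom {B : I ⥤ C} {i : I} {Z : C} (D' D : Shape B i Z) where
  /-- the map on bases -/
  base : ∀ f, D'.base.obj f ⟶ D.base.obj f
  /-- the map on total diagrams -/
  tot : ∀ f, D'.tot.obj f ⟶ D.tot.obj f
  q_base : ∀ f, D'.q f ≫ base f = tot f ≫ D.q f
  a_base : ∀ f, D'.a f ≫ base f = D.a f
  tot_b : ∀ f, tot f ≫ D.b f = D'.b f
  tot_map : ∀ {f f' : Under i} (g : f ⟶ f'), tot f ≫ D.tot.map g = D'.tot.map g ≫ tot f'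

variable [HasFiniteLimits C] {B X : I ⥤ C} {i : I} {Z : C} {D' D : Shape B i Z}
  (θ : D'.Hom D) (k : X ⟶ B)

/-- Precomposition with a map of shapes. -/
noncomputable abbrev Shape.Hom.precomp (f : Under i) {Y : C} (n : Y ⟶ B.obj f.right) :
    PshMap (homPsh (D.a f) (D.q f) (D.b f) n) (homPsh (D'.a f) (D'.q f) (D'.b f) n) :=
  homPsh.precomp n (θ.q_base f) (θ.a_base f) (θ.tot_b f)

/-- Precomposition of natural families with a map of shapes. -/
noncomputable def secPrecomp (S : Set (Under i)) : PshMap (secPsh D k S) (secPsh D' k S) where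
  app s :=
    { val := fun f hf => (s.val f hf).precomp (θ.q_base f) (θ.a_base f) (θ.tot_b f)
      natural := fun {f f'} hf hf' g V x y h => by
        rw [HomSec.eval_precomp, HomSec.eval_precomp, s.natural hf hf' g]
        refine HomSec.eval_congr _ rfl ?_ _
        rw [Category.assoc, Category.assoc, θ.tot_map] }
  app_res v hv s := by
    ext f hf : 3
    exact (θ.precomp f (k.app f.right)).app_res v hv (s.val f hf)

variable [∀ i : I, Finite (Under i)]

/-- One face of the cube to which the cogluing lemma is applied. -/
theorem secMatching_secPrecomp {S : Set (Under i)} (f : Under i)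
    (hf : ∀ h : Boundary f.right, extend f h ∈ S) {T : C} {t : T ⟶ Z} (s : Sec D k S t) :
    (secMatching D' k f hf).app ((secPrecomp θ k S).app s) =
      (θ.precomp f (relMatchingFst k f.right)).app ((secMatching D k f hf).app s) := by
  refine HomSec.ext_eval fun x y hxy => relMatchingObj_hom_ext ?_ fun h => ?_
  · rw [HomSec.eval_over, HomSec.eval_over]
  · refine (Sec.eval_matching_π _ _ _ _ _ _ _).trans (Eq.symm ?_)
    refine (congrArg (· ≫ relMatchingπ k f.right h) (HomSec.eval_precomp (θ.q_base f) (θ.a_base f)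
      (θ.tot_b f) _ x y hxy)).trans ?_
    refine (Sec.eval_matching_π s f hf x (y ≫ θ.tot f)
      (precomp_condition (θ.q_base f) (θ.a_base f) hxy) h).trans (Eq.symm ?_)
    refine (HomSec.eval_precomp (θ.q_base _) (θ.a_base _) (θ.tot_b _) _ _ _ _).trans ?_
    exact HomSec.eval_congr _ rfl (by rw [Category.assoc, Category.assoc, θ.tot_map]) _

variable {Fib W : MorphismProperty C} [Fib.IsMultiplicative] [Fib.IsStableUnderBaseChange]
  [W.IsMultiplicative] [W.HasTwoOutOfThreeProperty] [IsInverse I]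

/-- If precomposition with a map of shapes corresponds to weak equivalences between presheaves of
maps, then also between presheaves of natural families. -/
theorem weq_of_isRepMap_secPrecomp (hW : MorphismProperty.isomorphisms C ≤ W)
    (hFib : FibrationsStableUnderPushforward Fib) (hpb : PullbacksLogicallyBehaved Fib W)
    (hk : IsReedyFibration Fib k) (hq : ∀ f, Fib (D.q f)) (hq' : ∀ f, Fib (D'.q f))
    (H : ∀ (f : Under i) {Y : C} (n : Y ⟶ B.obj f.right), Fib n → ∀ {E R : C} {e : E ⟶ Z}
      {r : R ⟶ Z} {x : (homPsh (D.a f) (D.q f) (D.b f) n).obj e}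
      {y : (homPsh (D'.a f) (D'.q f) (D'.b f) n).obj r}, IsRep _ e x → IsRep _ r y →
      ∀ {d : E ⟶ R}, IsRepMap (θ.precomp f n) x y d → W d)
    {S : Set (Under i)} (hS : IsCosieve S) {E R : C} {e : E ⟶ Z} {r : R ⟶ Z}
    {x : (secPsh D k S).obj e} {y : (secPsh D' k S).obj r} (hx : IsRep (secPsh D k S) e x)
    (hy : IsRep (secPsh D' k S) r y) {d : E ⟶ R} (hd : IsRepMap (secPrecomp θ k S) x y d) :
    W d := by
  refine cosieve_induction (P := fun S => ∀ {E R : C} {e : E ⟶ Z} {r : R ⟶ Z}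
    {x : (secPsh D k S).obj e} {y : (secPsh D' k S).obj r} (_ : IsRep (secPsh D k S) e x)
    (_ : IsRep (secPsh D' k S) r y) {d : E ⟶ R} (_ : IsRepMap (secPrecomp θ k S) x y d), W d)
    ?_ ?_ hS hx hy hd
  · intro E R e r x y hx hy d hd
    obtain ⟨x₀, hx₀⟩ := isRep_sec_empty D k
    obtain ⟨y₀, hy₀⟩ := isRep_sec_empty D' k
    -- Families on the empty cosieve are represented by `Z` for both shapes, and precomposition
    -- becomes the identity.
    refine IsRepMap.weq hW (d := 𝟙 Z) ⟨Category.id_comp _, ?_⟩ hd hx₀ hy₀ hx hy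
      (weq_of_isIso hW _)
    ext g hg : 3
    exact hg.elim
  · intro f S hfS hS hf ih E E' e e' x x' hx hx' δ hδ
    obtain ⟨R, r, y, hy, -⟩ := exists_isRep_sec D k hFib hk hq hS
    obtain ⟨R', r', y', hy', -⟩ := exists_isRep_sec D' k hFib hk hq' hS
    obtain ⟨K, l, z, hz⟩ := exists_isRep_homPsh hFib (D.a f) (D.q f) (D.b f) (k.app f.right) (hq f)
      (hk.fib_app hFib f.right)
    obtain ⟨K', l', z', hz'⟩ := exists_isRep_homPsh hFib (D'.a f) (D'.q f) (D'.b f)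
      (k.app f.right) (hq' f) (hk.fib_app hFib f.right)
    obtain ⟨M, m, o, ho⟩ := exists_isRep_homPsh hFib (D.a f) (D.q f) (D.b f)
      (relMatchingFst k f.right) (hq f) (hk.fib_relMatchingFst hFib f.right)
    obtain ⟨M', m', o', ho'⟩ := exists_isRep_homPsh hFib (D'.a f) (D'.q f) (D'.b f)
      (relMatchingFst k f.right) (hq' f) (hk.fib_relMatchingFst hFib f.right)
    obtain ⟨eR, heR⟩ := hy.exists_map (secRestrict D k (Set.subset_insert f S)) x
    obtain ⟨eR', heR'⟩ := hy'.exists_map (secRestrict D' k (Set.subset_insert f S)) x'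
    obtain ⟨eK, heK⟩ := hz.exists_map (secEval D k f (Set.mem_insert f S)) x
    obtain ⟨eK', heK'⟩ := hz'.exists_map (secEval D' k f (Set.mem_insert f S)) x'
    obtain ⟨dR, hdR⟩ := ho.exists_map (secMatching D k f hf) y
    obtain ⟨dR', hdR'⟩ := ho'.exists_map (secMatching D' k f hf) y'
    obtain ⟨dK, hdK⟩ := ho.exists_map (homPsh.postcomp (D.a f) (D.q f) (D.b f)
      (relMatchingMap k f.right) (relMatchingMap_fst f.right)) z
    obtain ⟨dK', hdK'⟩ := ho'.exists_map (homPsh.postcomp (D'.a f) (D'.q f) (D'.b f)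
      (relMatchingMap k f.right) (relMatchingMap_fst f.right)) z'
    obtain ⟨α, hα⟩ := hz'.exists_map (θ.precomp f (k.app f.right)) z
    obtain ⟨β, hβ⟩ := hy'.exists_map (secPrecomp θ k S) y
    obtain ⟨γ, hγ⟩ := ho'.exists_map (θ.precomp f (relMatchingFst k f.right)) o
    have h := (pshPullback_sec D k f hfS hS hf).isPullback hx hy hz ho heR heK hdR hdK
    have h' := (pshPullback_sec D' k f hfS hS hf).isPullback hx' hy' hz' ho' heR' heK' hdR' hdK'
    -- Adding `f` is a pullback for each shape. Of the three maps between the cospans, `H` treats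
    -- `α` and `γ`, for the fibrations $X_j\to B_j$ and $B_j\times_{M_jB}M_jX\to B_j$, and induction
    -- treats `β`.
    refine hpb.weq_of_cospan h.flip h'.flip
      (fib_of_isRepMap_postcomp hFib _ _ (hk f.right) (hq f) hz ho hdK)
      (fib_of_isRepMap_postcomp hFib _ _ (hk f.right) (hq' f) hz' ho' hdK')
      (H f _ (hk.fib_app hFib f.right) hz hz' hα) (ih hy hy' hβ)
      (H f _ (hk.fib_relMatchingFst hFib f.right) ho ho' hγ) ?_ ?_ ?_ ?_
    · refine IsRepMap.comp_eq_comp ho' hα hdK' hdK hγ (HomSec.ext_eval fun x y h => ?_)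
      refine (HomSec.eval_postcomp _ (relMatchingMap_fst f.right) _ x y h).trans ?_
      refine (congrArg (· ≫ relMatchingMap k f.right) (HomSec.eval_precomp (θ.q_base f)
        (θ.a_base f) (θ.tot_b f) z x y h)).trans (Eq.symm ?_)
      exact (HomSec.eval_precomp (θ.q_base f) (θ.a_base f) (θ.tot_b f) _ x y h).trans
        (HomSec.eval_postcomp _ (relMatchingMap_fst f.right) z x _ _)
    · exact IsRepMap.comp_eq_comp ho' hβ hdR' hdR hγ (secMatching_secPrecomp θ k f hf y)
    · exact IsRepMap.comp_eq_comp hz' hδ heK' heK hα rfl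
    · exact IsRepMap.comp_eq_comp hy' hδ heR' heR hβ rfl

end ShapeHom

/-! ### The comparison maps, and the action of the pushforward on maps. -/

section Comparison

variable {I : Type u₁} [Category.{v₁} I] {C : Type u₂} [Category.{v₂} C]

theorem isPullback_map_id {B X : I ⥤ C} (k : X ⟶ B) (i : I) :
    IsPullback (𝟙 (X.obj i)) (k.app i) (k.app i) (B.map (𝟙 i)) :=
  IsPullback.of_horiz_isIso ⟨by simp⟩

/-- The constant shape at `p_i : B_i ⟶ A_i`. -/
abbrev Shape.const {B A : I ⥤ C} (p : B ⟶ A) (i : I) : Shape B i (A.obj i) where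
  base := (Functor.const _).obj (A.obj i)
  tot := (Functor.const _).obj (B.obj i)
  a f := 𝟙 _
  a_map g := Category.id_comp _
  q f := p.app i
  q_map g := (Category.id_comp _).trans (Category.comp_id _).symm
  b f := B.map f.hom
  b_map g := by
    rw [← B.map_comp, Under.w]
    exact Category.id_comp _

/-- The map from the constant shape at `p_i` to the restriction of `p` to `i/I`. -/
abbrev Shape.fromConst {B A : I ⥤ C} (p : B ⟶ A) (i : I) :
    (Shape.const p i).Hom (Shape.ofHom p i) where
  base f := A.map f.hom
  tot f := B.map f.hom
  q_base f := (p.naturality f.hom).symm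
  a_base f := Category.id_comp _
  tot_b f := Category.comp_id _
  tot_map g := by
    rw [← B.map_comp, Under.w]
    exact (Category.id_comp _).symm

theorem Pushforward.evalAt_map {X X' B A : C} {k : X ⟶ B} {k' : X' ⟶ B} {p : B ⟶ A}
    (P : Pushforward k p) (P' : Pushforward k' p) (w : X ⟶ X') (hw : w ≫ k' = k) {V : C}
    (x : V ⟶ P.obj) (y : V ⟶ B) (h : x ≫ P.hom = y ≫ p)
    (h' : (x ≫ P.map P' w hw) ≫ P'.hom = y ≫ p) :
    P'.evalAt (x ≫ P.map P' w hw) y h' = P.evalAt x y h ≫ w := by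
  rw [P'.evalAt_transpose P.hom P.proj (P.ev ≫ w) (by rw [Category.assoc, hw]; exact P.isPullback)
    _ _ h' (P.isPullback.lift x y h), evalAt, Category.assoc]
  · rw [← Category.assoc, P.isPullback.lift_fst]
    rfl
  · rw [Category.assoc, hw, P.isPullback.lift_snd]

theorem Pushforward.comparison_hom [HasPullbacks C] {B A X : I ⥤ C} {k : X ⟶ B} {p : B ⟶ A}
    (P : Pushforward k p) (j : I) (Pj : Pushforward (k.app j) (p.app j)) :
    P.comparison j Pj ≫ Pj.hom = P.hom.app j :=
  Pj.transpose_hom _ _ _ _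

theorem Pushforward.evalAt_comparison [HasPullbacks C] {B A X : I ⥤ C} {k : X ⟶ B} {p : B ⟶ A}
    (P : Pushforward k p) (j : I) (Pj : Pushforward (k.app j) (p.app j)) {V : C}
    (x : V ⟶ P.obj.obj j) (y : V ⟶ B.obj j) (h : x ≫ P.hom.app j = y ≫ p.app j)
    (h' : (x ≫ P.comparison j Pj) ≫ Pj.hom = y ≫ p.app j) :
    Pj.evalAt (x ≫ P.comparison j Pj) y h' = P.evalApp x y h := by
  refine Pj.evalAt_transpose _ _ _ (P.isPullback_app j) _ _ _ ((P.isPullback_app j).lift x y h)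
    ?_ ?_
  · rw [← Category.assoc, (P.isPullback_app j).lift_fst]
    rfl
  · exact (P.isPullback_app j).lift_snd _ _ _

variable [HasFiniteLimits C] {B A X : I ⥤ C} {k : X ⟶ B} {p : B ⟶ A}

/-- `𝟙 i` is initial in the underslice and the shape is constant, so naturality forces the component
at `f` to be the one at `𝟙 i` followed by `X.map f`. -/
theorem bijective_secEval_const (i : I) {T : C} (t : T ⟶ A.obj i) :
    Function.Bijective ((secEval (Shape.const p i) k (S := Set.univ) (Under.mk (𝟙 i)) trivial).app
      (t := t)) := by
  constructor
  · intro s s' h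
    ext f hf : 3
    refine HomSec.ext_eval fun x y hxy => ?_
    have e : ∀ s : Sec (Shape.const p i) k Set.univ t, (s.val f hf).eval x y hxy =
        (s.val (Under.mk (𝟙 i)) trivial).eval x y hxy ≫ X.map f.hom := fun s =>
      (HomSec.eval_congr _ rfl (Category.comp_id y).symm _).trans
        (s.natural (f := Under.mk (𝟙 i)) trivial hf (Under.homMk f.hom (Category.id_comp _))
          x y hxy).symm
    rw [e s, e s']
    exact congrArg (fun u : HomSec (𝟙 _) (p.app i) (B.map (𝟙 i)) (k.app i) t =>
      u.eval x y hxy ≫ X.map f.hom) h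
  · intro u
    refine ⟨⟨fun f hf => ⟨HomSec.hom u ≫ X.map f.hom, ?_⟩, ?_⟩, ?_⟩
    · rw [Category.assoc, k.naturality, ← Category.assoc, HomSec.hom_comp, Category.assoc,
        ← B.map_comp]
      exact congrArg (fun g => pullback.snd (t ≫ 𝟙 _) (p.app i) ≫ B.map g) (Category.id_comp _)
    · intro f f' hf hf' g V x y h
      simp only [HomSec.eval, Category.assoc]
      rw [← X.map_comp, Under.w]
      congr 1
      apply pullback.hom_ext
      · exact (pullback.lift_fst _ _ _).trans (pullback.lift_fst _ _ _).symm
      · exact (pullback.lift_snd _ _ _).trans ((Category.comp_id y).symm.trans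
          (pullback.lift_snd _ _ _).symm)
    · refine HomSec.ext ?_
      exact (congrArg (HomSec.hom u ≫ ·) (X.map_id i)).trans (Category.comp_id _)

/-- A pushforward of `k_i` along `p_i` represents natural families on the constant shape. The
comparison map corresponds to precomposition with the map from the constant shape. -/
theorem Pushforward.exists_isRep_const (P : Pushforward k p) (i : I)
    (Pi : Pushforward (k.app i) (p.app i)) :
    ∃ x : (secPsh (Shape.const p i) k Set.univ).obj Pi.hom,
      IsRep (secPsh (Shape.const p i) k Set.univ) Pi.hom x ∧
        IsRepMap (secPrecomp (Shape.fromConst p i) k Set.univ) (pullbackSec P.isPullback i) x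
          (P.comparison i Pi) := by
  have hb := fun {T : C} (t : T ⟶ A.obj i) => bijective_secEval_const (k := k) (p := p) i t
  have hG := Pi.isRep_homSec (isPullback_map_id k i) (IsPullback.id_horiz Pi.hom)
  obtain ⟨x, hx⟩ := (hb Pi.hom).2 (Pi.homSec (isPullback_map_id k i).toCommSq
    (IsPullback.id_horiz Pi.hom).toCommSq)
  rw [← hx] at hG
  refine ⟨x, IsRep.of_bijective _ hb hG, P.comparison_hom i Pi, (hb _).1 ?_⟩
  rw [PshMap.app_res, hx]
  refine HomSec.ext_eval fun {V} z (y : V ⟶ B.obj i) h => ?_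
  have h₁ : z ≫ P.hom.app i = y ≫ p.app i := by
    rw [← h]
    exact congrArg (z ≫ ·) (Category.comp_id _).symm
  have h₂ : (z ≫ P.comparison i Pi) ≫ Pi.hom = y ≫ p.app i := by
    rw [Category.assoc, P.comparison_hom, h₁]
  refine Eq.trans (homPsh.eval_res (P.comparison i Pi) (P.comparison_hom i Pi) _ z y h) ?_
  refine (Pi.eval_homSec (isPullback_map_id k i).toCommSq
    (IsPullback.id_horiz Pi.hom).toCommSq (z ≫ P.comparison i Pi) y _).trans ?_
  refine (Category.comp_id _).trans ?_
  refine (Pi.evalAt_congr (Category.comp_id _) rfl _).trans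
    ((P.evalAt_comparison i Pi z y h₁ h₂).trans (Eq.symm ?_))
  refine (HomSec.eval_precomp ((Shape.fromConst p i).q_base (Under.mk (𝟙 i)))
    ((Shape.fromConst p i).a_base (Under.mk (𝟙 i)))
    ((Shape.fromConst p i).tot_b (Under.mk (𝟙 i))) _ z y _).trans ?_
  have h₃ : z ≫ P.hom.app i ≫ A.map (𝟙 i) = (y ≫ B.map (𝟙 i)) ≫ p.app i := by
    rw [A.map_id, B.map_id, Category.comp_id, Category.comp_id, h₁]
  refine (P.ev_pullbackSec (𝟙 i) z (y ≫ B.map (𝟙 i)) h₃).trans (P.evalApp_congr ?_ ?_ _)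
  · rw [P.obj.map_id, Category.comp_id]
  · rw [B.map_id, Category.comp_id]

variable {Fib W : MorphismProperty C} [Fib.IsStableUnderBaseChange] [W.HasTwoOutOfThreeProperty]

/-- A pushforward of diagrams sends a weak equivalence to a weak equivalence if the comparison
maps at its source and target are weak equivalences. -/
theorem Pushforward.weq_map_of_weq_comparison
    (hFib : FibrationsStableUnderPushforward Fib) (hpb : PullbacksLogicallyBehaved Fib W)
    (hpf : PushforwardsLogicallyBehaved Fib W) {i j : I} (f : i ⟶ j)
    (hX : W (X.map f)) (hB : W (B.map f)) (hA : W (A.map f))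
    (hp : ∀ j, Fib (p.app j)) (hk : ∀ j, Fib (k.app j)) (P : Pushforward k p)
    (Pi : Pushforward (k.app i) (p.app i)) (Pj : Pushforward (k.app j) (p.app j))
    (hi : W (P.comparison i Pi)) (hj : W (P.comparison j Pj)) : W (P.obj.map f) := by
  have hF := IsPullback.of_hasPullback Pj.hom (A.map f)
  have hD := IsPullback.of_hasPullback (k.app j) (B.map f)
  have hk' : Fib (pullback.snd (k.app j) (B.map f)) := Fib.of_isPullback hD (hk j)
  obtain ⟨P'⟩ := hFib.nonempty_pushforward _ (p.app i) hk' (hp i)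
  -- The maps `c` and `a` are the gaps of $X_f$ over $B_f$ and of $\kappa_j\circ(p_*X)_f$ over
  -- $A_f$. The plan is to relate them by `key` and then cancel weak equivalences.
  let c : X.obj i ⟶ pullback (k.app j) (B.map f) :=
    pullback.lift (X.map f) (k.app i) (k.naturality f)
  have hc₁ : c ≫ pullback.fst _ _ = X.map f := pullback.lift_fst _ _ _
  have hc₂ : c ≫ pullback.snd _ _ = k.app i := pullback.lift_snd _ _ _
  have hcW : W c := W.of_postcomp _ _ (hpb.weq_of_isPullback hD (hk j) hB) (by rwa [hc₁])
  let a : P.obj.obj i ⟶ pullback Pj.hom (A.map f) :=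
    pullback.lift (P.obj.map f ≫ P.comparison j Pj) (P.hom.app i) (by
      rw [Category.assoc, P.comparison_hom, P.hom.naturality])
  have ha₁ : a ≫ pullback.fst _ _ = P.obj.map f ≫ P.comparison j Pj := pullback.lift_fst _ _ _
  have ha₂ : a ≫ pullback.snd _ _ = P.hom.app i := pullback.lift_snd _ _ _
  have sq := p.naturality f
  have hr : Pj.precomp sq hF hD P' ≫ P'.hom = pullback.snd _ _ := P'.transpose_hom _ _ _ _
  have hm : Pi.map P' c hc₂ ≫ P'.hom = Pi.hom := P'.transpose_hom _ _ _ _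
  have key : a ≫ Pj.precomp sq hF hD P' = P.comparison i Pi ≫ Pi.map P' c hc₂ := by
    have e₁ : (a ≫ Pj.precomp sq hF hD P') ≫ P'.hom = P.hom.app i := by
      rw [Category.assoc, hr, ha₂]
    have e₂ : (P.comparison i Pi ≫ Pi.map P' c hc₂) ≫ P'.hom = P.hom.app i := by
      rw [Category.assoc, hm, P.comparison_hom]
    have hY := IsPullback.of_hasPullback (P.hom.app i) (p.app i)
    generalize pullback.fst (P.hom.app i) (p.app i) = y at hY
    generalize pullback.snd (P.hom.app i) (p.app i) = b at hY
    have h₁ : ((y ≫ a) ≫ Pj.precomp sq hF hD P') ≫ P'.hom = b ≫ p.app i := by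
      rw [Category.assoc, Category.assoc, hr, ha₂, hY.w]
    have h₂ : ((y ≫ P.comparison i Pi) ≫ Pi.map P' c hc₂) ≫ P'.hom = b ≫ p.app i := by
      rw [Category.assoc, Category.assoc, hm, P.comparison_hom, hY.w]
    have h₃ : (y ≫ P.comparison i Pi) ≫ Pi.hom = b ≫ p.app i := by
      rw [Category.assoc, P.comparison_hom, hY.w]
    have h₄ : (y ≫ P.obj.map f) ≫ P.hom.app j = (b ≫ B.map f) ≫ p.app j := by
      rw [Category.assoc, P.hom.naturality, reassoc_of% hY.w, Category.assoc, sq]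
    -- The two maps are compared by their values in $X_j\times_{B_j}B_i$. After projection to $X_j$
    -- both are the evaluation of `P` at `y ≫ P.obj.map f` and `b ≫ B.map f`.
    refine P'.hom_ext (e₁.trans e₂.symm) (by rw [e₁]; exact hY) (hD.hom_ext ?_ ?_)
    · rw [P'.evalAt_congr (Category.assoc _ _ _).symm rfl,
        P'.evalAt_congr (x := y ≫ P.comparison i Pi ≫ Pi.map P' c hc₂)
          (Category.assoc _ _ _).symm rfl,
        Pj.evalAt_precomp sq hF hD P' (y ≫ a) b (by rw [Category.assoc, ha₂, hY.w]) h₁,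
        Pi.evalAt_map P' c hc₂ _ _ h₃ h₂, Category.assoc
          (Pi.evalAt _ _ _), hc₁, P.evalAt_comparison i Pi y b hY.w,
        P.evalApp_map, ← P.evalAt_comparison j Pj _ _ h₄ (by
          rw [Category.assoc, P.comparison_hom, h₄])]
      exact Pj.evalAt_congr (by rw [Category.assoc, ha₁, Category.assoc]) rfl _
    · rw [P'.evalAt_comp, P'.evalAt_comp]
  have haW : W a := by
    refine W.of_postcomp _ (Pj.precomp sq hF hD P')
      (hpf.weq_precomp Pj sq hF hD P' (hk j) (hp j) (hp i) hA hB) ?_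
    rw [key]
    exact W.comp_mem _ _ hi (hpf.weq_map Pi P' c hc₂ (hp i) (hk i) hk' hcW)
  -- $\kappa_j\circ(p_*X)_f$ is `a` followed by the base change of $A_f$ along the fibration
  -- $(p_j)_*X_j\to A_j$.
  refine W.of_postcomp _ (P.comparison j Pj) hj ?_
  rw [← ha₁]
  exact W.comp_mem _ _ haW (hpb.weq_of_isPullback hF (hFib.fib_hom Pj (hk j) (hp j)) hA)

variable [∀ i : I, Finite (Under i)] [IsInverse I] {WI : MorphismProperty I}
  [Fib.IsMultiplicative] [W.IsMultiplicative]

/-- The comparison map is a weak equivalence at an object such that all maps out of it are weak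
equivalences. -/
theorem Pushforward.weq_comparison (hW : MorphismProperty.isomorphisms C ≤ W)
    (hFib : FibrationsStableUnderPushforward Fib) (hpb : PullbacksLogicallyBehaved Fib W)
    (hpf : PushforwardsLogicallyBehaved Fib W) {i : I} (hi : ∀ (j : I) (f : i ⟶ j), WI f)
    (hB : IsHomotopical WI W B) (hA : IsHomotopical WI W A) (hp : ∀ j, Fib (p.app j))
    (hk : IsReedyFibration Fib k) (P : Pushforward k p) (Pi : Pushforward (k.app i) (p.app i)) :
    W (P.comparison i Pi) := by
  obtain ⟨x, hx, hκ⟩ := P.exists_isRep_const i Pi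
  -- At each `f` out of `i`, assumption (4) applies to the naturality square of `p` at `f.hom`,
  -- because `A` and `B` are homotopical and `f.hom` is a weak equivalence.
  exact weq_of_isRepMap_secPrecomp (Shape.fromConst p i) k hW hFib hpb hk (fun f => hp f.right)
    (fun _ => hp i) (fun f Y n hn E R e r x y hx hy d hd =>
      hpf.weq_of_isRepMap_precomp hW hFib ((Shape.fromConst p i).q_base f) hn (hp f.right) (hp i)
        (hA _ (hi _ f.hom)) (hB _ (hi _ f.hom)) hx hy hd) (isCosieve_univ i)
    (P.isRep_pullbackSec_of_reedy hFib hk hp i) hx hκ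

end Comparison

end InverseDiagrams

/-! ### The lemma. -/

theorem mainTheorem3
    {I : Type u₁} [Category.{v₁} I] [InverseDiagrams.IsInverse I] [∀ i : I, Finite (Under i)]
    {C : Type u₂} [Category.{v₂} C] [HasFiniteLimits C]
    -- weak equivalences in `I`
    (WI : MorphismProperty I) [WI.IsMultiplicative] [WI.HasTwoOutOfThreeProperty]
    (hWI : MorphismProperty.isomorphisms I ≤ WI)
    -- weak equivalences in `C`
    (W : MorphismProperty C) [W.IsMultiplicative] [W.HasTwoOutOfThreeProperty]
    (hW : MorphismProperty.isomorphisms C ≤ W)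
    -- fibrations in `C`
    (Fib : MorphismProperty C) [Fib.IsMultiplicative] [Fib.IsStableUnderBaseChange]
    (hFib : InverseDiagrams.FibrationsStableUnderPushforward Fib)
    (hpb : InverseDiagrams.PullbacksLogicallyBehaved Fib W)
    (hpf : InverseDiagrams.PushforwardsLogicallyBehaved Fib W)
    -- all maps out of `i` are weak equivalences
    (i : I) (hi : ∀ (j : I) (f : i ⟶ j), WI f)
    {X B A : I ⥤ C}
    (hX : InverseDiagrams.IsHomotopical WI W X)
    (hB : InverseDiagrams.IsHomotopical WI W B)
    (hA : InverseDiagrams.IsHomotopical WI W A)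
    (p : B ⟶ A) (hp : InverseDiagrams.IsReedyFibration Fib p)
    (k : X ⟶ B) (hk : InverseDiagrams.IsReedyFibration Fib k) :
    -- the pushforward `p_* X` exists, and whichever choice `P` of it is taken:
    Nonempty (InverseDiagrams.Pushforward k p) ∧
    ∀ P : InverseDiagrams.Pushforward k p,
      InverseDiagrams.IsReedyFibration Fib P.hom ∧
      -- all maps out of `i` are sent to weak equivalences
      (∀ (j : I) (f : i ⟶ j), W (P.obj.map f)) ∧
      -- the comparison map at each `j` under `i` is a weak equivalence
      (∀ (j : I) (_ : i ⟶ j),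
        Nonempty (InverseDiagrams.Pushforward (k.app j) (p.app j)) ∧
        ∀ Pj : InverseDiagrams.Pushforward (k.app j) (p.app j), W (P.comparison j Pj)) := by
  have hp' := hp.fib_app hFib
  have hk' := hk.fib_app hFib
  refine ⟨InverseDiagrams.nonempty_pushforward_of_reedy hFib hk hp', fun P => ?_⟩
  -- For `f : i ⟶ j` and `g : j ⟶ l`, both `f` and `f ≫ g` start at `i`; by 2-out-of-3 `g` is a weak
  -- equivalence, so `j` satisfies the hypothesis imposed on `i`.
  have hκ : ∀ (j : I) (_ : i ⟶ j) (Pj : InverseDiagrams.Pushforward (k.app j) (p.app j)),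
      W (P.comparison j Pj) := fun j f Pj =>
    P.weq_comparison (WI := WI) hW hFib hpb hpf
      (fun l g => WI.of_precomp f g (hi j f) (hi l (f ≫ g))) hB hA hp' hk Pj
  have hne := fun j => hFib.nonempty_pushforward (k.app j) (p.app j) (hk' j) (hp' j)
  refine ⟨P.isReedyFibration_hom hFib hk hp', fun j f => ?_, fun j f => ⟨hne j, hκ j f⟩⟩
  obtain ⟨Pi⟩ := hne i
  obtain ⟨Pj⟩ := hne j
  exact P.weq_map_of_weq_comparison hFib hpb hpf f (hX f (hi j f)) (hB f (hi j f)) (hA f (hi j f))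
    hp' hk' Pi Pj (hκ i (𝟙 i) Pi) (hκ j f Pj)
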